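/- A \emph{semicomplete multipartite digraph} is a finite digraph obtained from a complete $p$-partite graph ($p\ge 2$, all classes non-empty) by replacing every edge $\{x,y\}$ with the arc $xy$, or the arc $yx$, or both. Its \emph{partite sets} are its maximal independent vertex sets; if their sizes are $n_1,\dots,n_p$, the \emph{HP-majority inequality} is $2\max_i n_i\le \left(\sum_i n_i\right)+1$. A \emph{Hamilton oriented path} $P$ in a digraph $D$ consists of an ordering $v_1v_2\dots v_n$ of all vertices of $D$ and, for each $i<n$, exactly one arc of $D$ between $v_i$ and $v_{i+1}$, which is called \emph{forward} if it is $v_iv_{i+1}$ and \emph{backward} if it is $v_{i+1}v_i$. Let $\sigma_{\max}(P)$ be the larger of the number of forward arcs and the number of backward arcs of $P$. The \emph{symmetric (0,1)-digraph} $\hat D$ of $D$ is obtained from $D$ by assigning cost $1$ to all arcs of $D$ and adding, for every arc $xy$ of $D$ such that $yx$ is not an arc of $D$, the arc $yx$ with cost $0$. A \emph{1-path-cycle factor} of $\hat D$ is a spanning subdigraph of $\hat D$ that consists of one directed path (with at least one vertex) and a possibly empty collection of directed cycles (of length at least $2$), all vertex-disjoint; its cost is the sum of the costs of its arcs. \textbf{Theorem.}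 Let $D$ be an $n$-vertex semicomplete multipartite digraph satisfying the HP-majority inequality. Let $\sigma^{hp}_{\max}$ be the maximum of $\sigma_{\max}(P)$ over all Hamilton oriented paths $P$ in $D$, and let $c^{pc}_{\max}$ be the maximum cost of a 1-path-cycle factor in $\hat D$. Then both maxima exist and $\sigma^{hp}_{\max}=c^{pc}_{\max}$. Moreover, both the number $\sigma^{hp}_{\max}$ and a Hamilton oriented path $P$ with $\sigma_{\max}(P)=\sigma^{hp}_{\max}$ can be found in time polynomial in $n$: there are a single algorithm and a polynomial $q$ such that on every such $D$, given by its adjacency matrix, the algorithm halts with a correct output after at most $q(n)$ steps. -/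

import Mathlib

namespace HamOP

/-! ### Semicomplete multipartite digraphs -/

section Digraphs

variable {V : Type*}

/-- `D` is obtained from a complete `p`-partite graph (`p ≥ 2`, with non-empty classes, the fibres
of `c`) by replacing every edge `{x, y}` with the arc `xy`, the arc `yx`, or both. -/
def IsSemicompleteMultipartite (D : Digraph V) : Prop :=
  ∃ (p : ℕ) (c : V → Fin p), 2 ≤ p ∧ Function.Surjective c ∧
    ∀ x y, (D.Adj x y ∨ D.Adj y x) ↔ c x ≠ c y

/-- No arc of `D` joins two vertices of `S`. -/
def IsIndependent (D : Digraph V) (S : Finset V) : Prop :=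
  ∀ x ∈ S, ∀ y ∈ S, ¬ D.Adj x y

/-- The partite sets of a semicomplete multipartite digraph: its maximal independent sets. -/
def IsPartiteSet (D : Digraph V) (S : Finset V) : Prop :=
  Maximal (IsIndependent D) S

/-- The HP-majority inequality `2 max nᵢ ≤ (∑ nᵢ) + 1`, where the `nᵢ` are the sizes of the
partite sets. As the partite sets partition the vertex set, `∑ nᵢ` is the number of vertices. -/
def HPMajority [Fintype V] (D : Digraph V) : Prop :=
  ∀ S : Finset V, IsPartiteSet D S → 2 * S.card ≤ Fintype.card V + 1

/-! ### Hamilton oriented paths -/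

/-- An oriented path `v₁ v₂ … v_k` in `D`, listed in one of its two orders: the vertices are
distinct, and between consecutive vertices exactly one arc of `D` is chosen, either the forward
arc `vᵢ vᵢ₊₁` or the backward arc `vᵢ₊₁ vᵢ`. -/
structure OrientedPath (D : Digraph V) (k : ℕ) where
  /-- the sequence of vertices -/
  vert : Fin k → V
  vert_injective : Function.Injective vert
  /-- whether the arc between the `i`-th vertex and the next one is forward -/
  fwd : Fin (k - 1) → Bool
  arc_mem : ∀ i : Fin (k - 1),
    if fwd i then D.Adj (vert ⟨i, by omega⟩) (vert ⟨i + 1, by omega⟩)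
    else D.Adj (vert ⟨i + 1, by omega⟩) (vert ⟨i, by omega⟩)

namespace OrientedPath

variable {D : Digraph V} {k : ℕ}

/-- The path is Hamilton: it visits every vertex of `D`. -/
def IsHamilton (P : OrientedPath D k) : Prop := Function.Surjective P.vert

/-- The number of forward arcs. -/
def sigmaPlus (P : OrientedPath D k) : ℕ := (Finset.univ.filter fun i => P.fwd i = true).card

/-- The number of backward arcs. -/
def sigmaMinus (P : OrientedPath D k) : ℕ := (Finset.univ.filter fun i => P.fwd i = false).card

/-- `σ_max(P) = max {σ⁺(P), σ⁻(P)}`. -/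
def sigmaMax (P : OrientedPath D k) : ℕ := max P.sigmaPlus P.sigmaMinus

end OrientedPath

/-- The set of the values `σ_max(P)` over all Hamilton oriented paths `P` in `D`. -/
def hamiltonSigmaValues (D : Digraph V) : Set ℕ :=
  {m | ∃ (k : ℕ) (P : OrientedPath D k), P.IsHamilton ∧ P.sigmaMax = m}

/-! ### The symmetric (0,1)-digraph and 1-path-cycle factors -/

/-- The arcs of the symmetric (0,1)-digraph of `D`: those of `D` and their reverses. -/
def symDigraph (D : Digraph V) : Digraph V where
  Adj x y := D.Adj x y ∨ D.Adj y x

open Classical in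
/-- The cost of an arc of the symmetric (0,1)-digraph of `D`: `1` for the arcs of `D`, and `0` for
the added ones. -/
noncomputable def arcCost (D : Digraph V) (a : V × V) : ℕ :=
  if D.Adj a.1 a.2 then 1 else 0

/-- The arcs `v₁v₂, v₂v₃, …, v_{k-1}v_k` of the directed path `v₁ v₂ … v_k`. -/
def pathArcs (l : List V) : List (V × V) := l.zip l.tail

/-- The arcs `v₁v₂, …, v_{k-1}v_k, v_kv₁` of the directed cycle `v₁ v₂ … v_k v₁`. -/
def cycleArcs (l : List V) : List (V × V) := l.zip (l.rotate 1)

/-- A 1-path-cycle factor in `H`: a (directed) path, with at least one vertex, and a (possibly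
empty) collection of (directed) cycles, all vertex-disjoint, that together cover all vertices. -/
structure PathCycleFactor (H : Digraph V) where
  path : List V
  cycles : List (List V)
  path_ne_nil : path ≠ []
  two_le_length : ∀ c ∈ cycles, 2 ≤ c.length
  path_arcs_mem : ∀ a ∈ pathArcs path, H.Adj a.1 a.2
  cycle_arcs_mem : ∀ c ∈ cycles, ∀ a ∈ cycleArcs c, H.Adj a.1 a.2
  nodup : (path ++ cycles.flatten).Nodup
  spanning : ∀ v : V, v ∈ path ++ cycles.flatten

/-- The list of all arcs of a 1-path-cycle factor. -/
def PathCycleFactor.arcs {H : Digraph V} (F : PathCycleFactor H) : List (V × V) :=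
  pathArcs F.path ++ (F.cycles.map cycleArcs).flatten

/-- The cost of a 1-path-cycle factor in the symmetric (0,1)-digraph of `D`. -/
noncomputable def factorCost (D : Digraph V) (F : PathCycleFactor (symDigraph D)) : ℕ :=
  (F.arcs.map (arcCost D)).sum

/-- The set of the costs of all 1-path-cycle factors in the symmetric (0,1)-digraph of `D`. -/
def factorCosts (D : Digraph V) : Set ℕ := Set.range (factorCost D)

end Digraphs

/-! ### A random access machine with a step count

Programs are `while`-programs over natural-number variables and two-dimensional arrays of natural
numbers; a program mentions finitely many variables and arrays. The arithmetic consists of addition,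
truncated subtraction and comparisons, each at unit cost. There is no multiplication, so after `t`
steps all numbers have `O(t + s)` bits, where `s` is the largest bit length in the input, and running
times agree with those of Turing machines up to polynomial factors. -/

namespace RAM

/-- Expressions. `get a i j` is the entry with indices `i, j` of the array `a`. -/
inductive Expr : Type
  | lit (m : ℕ)
  | var (x : ℕ)
  | get (a : ℕ) (i j : Expr)
  | add (e f : Expr)
  | sub (e f : Expr)
  | lt (e f : Expr)
  | eq (e f : Expr)

/-- Programs. `store a i j e` writes the value of `e` to the entry `i, j` of the array `a`. A test
succeeds if its value is non-zero. -/
inductive Prog : Type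
  | skip
  | assign (x : ℕ) (e : Expr)
  | store (a : ℕ) (i j e : Expr)
  | seq (c d : Prog)
  | ite (e : Expr) (c d : Prog)
  | while (e : Expr) (c : Prog)

/-- A memory state: the values of the variables and of the array entries. -/
structure State : Type where
  var : ℕ → ℕ
  arr : ℕ → ℕ → ℕ → ℕ

/-- Write the value `v` to the variable `x`. -/
def State.setVar (s : State) (x v : ℕ) : State where
  var y := if y = x then v else s.var y
  arr := s.arr

/-- Write the value `v` to the entry `i, j` of the array `a`. -/
def State.setArr (s : State) (a i j v : ℕ) : State where
  var := s.var
  arr b k l := if b = a ∧ k = i ∧ l = j then v else s.arr b k l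

/-- The value of an expression; a comparison has value `1` if it holds and `0` otherwise. -/
def Expr.eval (s : State) : Expr → ℕ
  | lit m => m
  | var x => s.var x
  | get a i j => s.arr a (i.eval s) (j.eval s)
  | add e f => e.eval s + f.eval s
  | sub e f => e.eval s - f.eval s
  | lt e f => if e.eval s < f.eval s then 1 else 0
  | eq e f => if e.eval s = f.eval s then 1 else 0

/-- The number of operations that are carried out when an expression is evaluated. -/
def Expr.size : Expr → ℕ
  | lit _ => 1
  | var _ => 1
  | get _ i j => i.size + j.size + 1
  | add e f => e.size + f.size + 1
  | sub e f => e.size + f.size + 1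
  | lt e f => e.size + f.size + 1
  | eq e f => e.size + f.size + 1

/-- `Exec c s t s'`: the program `c`, started in the state `s`, halts after exactly `t` steps in the
state `s'`. -/
inductive Exec : Prog → State → ℕ → State → Prop
  | skip (s : State) : Exec .skip s 1 s
  | assign (s : State) (x : ℕ) (e : Expr) :
      Exec (.assign x e) s (e.size + 1) (s.setVar x (e.eval s))
  | store (s : State) (a : ℕ) (i j e : Expr) :
      Exec (.store a i j e) s (i.size + j.size + e.size + 1)
        (s.setArr a (i.eval s) (j.eval s) (e.eval s))
  | seq {s s' s'' : State} {c d : Prog} {t u : ℕ} :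
      Exec c s t s' → Exec d s' u s'' → Exec (.seq c d) s (t + u) s''
  | ite_true {s s' : State} {e : Expr} {c d : Prog} {t : ℕ} :
      e.eval s ≠ 0 → Exec c s t s' → Exec (.ite e c d) s (e.size + 1 + t) s'
  | ite_false {s s' : State} {e : Expr} {c d : Prog} {t : ℕ} :
      e.eval s = 0 → Exec d s t s' → Exec (.ite e c d) s (e.size + 1 + t) s'
  | while_true {s s' s'' : State} {e : Expr} {c : Prog} {t u : ℕ} :
      e.eval s ≠ 0 → Exec c s t s' → Exec (.while e c) s' u s'' →
        Exec (.while e c) s (e.size + 1 + t + u) s''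
  | while_false {s : State} {e : Expr} {c : Prog} :
      e.eval s = 0 → Exec (.while e c) s (e.size + 1) s

end RAM

open Classical in
/-- The input for a digraph `D` on the vertices `0, …, n - 1`: variable `0` holds `n`, array `0` holds
the adjacency matrix of `D`, and everything else is `0`. -/
noncomputable def inputState {n : ℕ} (D : Digraph (Fin n)) : RAM.State where
  var x := if x = 0 then n else 0
  arr a i j := if a = 0 ∧ ∃ (hi : i < n) (hj : j < n), D.Adj ⟨i, hi⟩ ⟨j, hj⟩ then 1 else 0

/-- The state `s` holds the oriented path `P` as an output: its vertices, in order, are the entries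
`(i, 0)` of array `1`, and the directions of its arcs (`1` for forward, `0` for backward) are the
entries `(i, 0)` of array `2`. -/
def OutputsPath {n k : ℕ} {D : Digraph (Fin n)} (s : RAM.State) (P : OrientedPath D k) : Prop :=
  (∀ i : Fin k, s.arr 1 i 0 = P.vert i) ∧
    ∀ i : Fin (k - 1), s.arr 2 i 0 = if P.fwd i then 1 else 0

end HamOP

namespace HamOP

/-! ### Permutations of a finite set with 0-1 weights -/

section Weights

variable {U κ : Type*}

/-- The 0-1 weight `w` is positive on at least one of `(x, y)`, `(y, x)` if the colours of `x`, `y`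
differ, and on none of them otherwise. -/
structure IsSemicompleteWeight (w : U → U → ℕ) (c : U → κ) : Prop where
  le_one : ∀ x y, w x y ≤ 1
  eq_zero : ∀ x y, c x = c y → w x y = 0
  one_le : ∀ x y, c x ≠ c y → 1 ≤ w x y + w y x

/-- A permutation that changes the colour of every element. -/
def IsProper (c : U → κ) (σ : Equiv.Perm U) : Prop := ∀ x, c x ≠ c (σ x)

/-- The total weight of the arcs `(x, σ x)`. -/
def weight [Fintype U] (w : U → U → ℕ) (σ : Equiv.Perm U) : ℕ := ∑ x, w x (σ x)

/-- A proper permutation of maximum weight among the proper ones. -/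
def IsOptimal [Fintype U] (w : U → U → ℕ) (c : U → κ) (σ : Equiv.Perm U) : Prop :=
  IsProper c σ ∧ ∀ τ, IsProper c τ → weight w τ ≤ weight w σ

variable {w : U → U → ℕ} {c : U → κ} {σ : Equiv.Perm U} {r : U}

theorem IsProper.apply_ne (hσ : IsProper c σ) (v : U) : σ v ≠ v := fun e => hσ v (by rw [e])

theorem IsOptimal.mono [Fintype U] {τ : Equiv.Perm U} (h : IsOptimal w c σ) (hτ : IsProper c τ)
    (hle : weight w σ ≤ weight w τ) : IsOptimal w c τ :=
  ⟨hτ, fun ρ hρ => (h.2 ρ hρ).trans hle⟩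

theorem IsSemicompleteWeight.ne (hw : IsSemicompleteWeight w c) {x y : U} (h : w x y = 1) :
    c x ≠ c y := fun e => by simp [hw.eq_zero x y e] at h

theorem IsSemicompleteWeight.eq_one (hw : IsSemicompleteWeight w c) {x y : U} (h : c x ≠ c y)
    (h' : w x y ≠ 1) : w y x = 1 := by
  have := hw.le_one x y
  have := hw.le_one y x
  have := hw.one_le x y h
  omega

/-- If neither exchange between the cycle of the universal element `r` and the other cycles of the
proper permutation `σ` is possible, then `σ` has no other cycles. -/
theorem sameCycle_of_no_exchange [Finite U] (hw : IsSemicompleteWeight w c)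
    (hr : ∀ x, x ≠ r → w r x = 1 ∧ w x r = 1) (hσ : IsProper c σ)
    (h₁ : ∀ y x, σ.SameCycle r y → ¬ σ.SameCycle r x → ¬ (w y (σ x) = 1 ∧ w x (σ y) = 1))
    (h₂ : ∀ p x z, σ.SameCycle r p → ¬ σ.SameCycle r x → ¬ σ.SameCycle r z → x ≠ z → σ p ≠ r →
      ¬ (w x (σ p) = 1 ∧ w (σ p) (σ x) = 1 ∧ w p (σ z) = 1 ∧ w z (σ (σ p)) = 1))
    (x₀ : U) : σ.SameCycle r x₀ := by
  by_contra hx₀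
  have hA : ∀ x, σ.SameCycle r (σ x) ↔ σ.SameCycle r x := fun x =>
    Equiv.Perm.sameCycle_apply_right
  have hne : ∀ x, ¬ σ.SameCycle r x → x ≠ r := by
    rintro x hx rfl
    exact hx (Equiv.Perm.SameCycle.refl _ _)
  -- No p on the cycle is good, by induction on a number d of steps from p to r. Requiring d ≥ 1
  -- lets the claim apply to r itself after a full turn, and r is good.
  have key : ∀ d : ℕ, ∀ p, 1 ≤ d → σ.SameCycle r p → (σ ^ d) p = r →
      ¬ ∀ x, ¬ σ.SameCycle r x → c x ≠ c p → w p x = 1 := by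
    intro d
    induction d using Nat.strong_induction_on with
    | _ d ih =>
      intro p hd hp hpd good
      by_cases hq : σ p = r
      -- `σ x₀` and its image have different colours, so at least one of them differs in colour from
      -- p.
      · have : ∃ x, ¬ σ.SameCycle r x ∧ c (σ x) ≠ c p := by
          by_cases h : c (σ x₀) = c p
          · exact ⟨σ x₀, by rwa [hA], fun h' => hσ (σ x₀) (h.trans h'.symm)⟩
          · exact ⟨x₀, hx₀, h⟩
        obtain ⟨x, hx, hc⟩ := this
        exact h₁ p x hp hx ⟨good _ (by rwa [hA]) hc, hq ▸ (hr x (hne x hx)).2⟩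
      have hd2 : 2 ≤ d := by
        by_contra h
        obtain rfl : d = 1 := by omega
        exact hq (by simpa using hpd)
      have hq' : (σ ^ (d - 1)) (σ p) = r := by
        rw [← Equiv.Perm.mul_apply, ← pow_succ, Nat.sub_add_cancel hd, hpd]
      have ih₁ := ih (d - 1) (by omega) (σ p) (by omega) ((hA p).2 hp) hq'
      push Not at ih₁
      -- The successor of p is not good, so semicompleteness yields an arc of weight 1 into it from
      -- outside.
      obtain ⟨x, hx, hxq, hwx⟩ := ih₁
      have hxq1 : w x (σ p) = 1 := hw.eq_one hxq.symm hwx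
      have hcp : c (σ x) = c p := by
        by_contra h
        exact h₁ p x hp hx ⟨good _ (by rwa [hA]) h, hxq1⟩
      -- the same argument serves for every element outside the cycle whose image has the colour of `p`
      have back : ∀ z, ¬ σ.SameCycle r z → c (σ z) = c p → w (σ p) (σ z) = 1 := by
        intro z hz hc
        have hz' : ¬ σ.SameCycle r (σ z) := by rwa [hA]
        have h1 : w (σ z) (σ p) ≠ 1 := fun h =>
          h₁ p (σ z) hp hz' ⟨good _ (by rwa [hA]) fun h' => hσ (σ z) (hc.trans h'.symm), h⟩
        exact hw.eq_one (fun h => hσ p (hc.symm.trans h)) h1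
      -- The second successor also receives weight 1 from outside: from everything if it is r, and
      -- otherwise because it is not good.
      have hz : ∃ z, ¬ σ.SameCycle r z ∧ w z (σ (σ p)) = 1 := by
        by_cases hrr : σ (σ p) = r
        · exact ⟨x₀, hx₀, hrr ▸ (hr x₀ (hne x₀ hx₀)).2⟩
        have hd3 : 3 ≤ d := by
          by_contra h
          obtain rfl : d = 2 := by omega
          exact hrr (by simpa [pow_succ] using hpd)
        have hr' : (σ ^ (d - 2)) (σ (σ p)) = r := by
          rw [← Equiv.Perm.mul_apply, ← pow_succ, show d - 2 + 1 = d - 1 by omega, hq']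
        have ih₂ := ih (d - 2) (by omega) (σ (σ p)) (by omega) (by rwa [hA, hA]) hr'
        push Not at ih₂
        obtain ⟨z, hz, hzc, hwz⟩ := ih₂
        exact ⟨z, hz, hw.eq_one hzc.symm hwz⟩
      obtain ⟨z, hz, hwz⟩ := hz
      -- In the first case `back` supplies the missing arc for swapping the images of `σ p` and z.
      -- In the second, p is good towards `σ z`, and x differs from z because the colours of their
      -- images differ.
      by_cases hc : c (σ z) = c p
      · exact h₁ (σ p) z ((hA p).2 hp) hz ⟨back z hz hc, hwz⟩
      · refine h₂ p x z hp hx hz ?_ hq ⟨hxq1, back x hx hcp, good _ (by rwa [hA]) hc, hwz⟩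
        rintro rfl
        exact hc hcp
  refine key (orderOf σ) r (orderOf_pos σ) (Equiv.Perm.SameCycle.refl _ _)
    (by rw [pow_orderOf_eq_one]; rfl) fun x hx _ => (hr x (hne x hx)).1

/-- If membership in `B` is preserved by `σ` on an invariant set with the possible exception of one
element, then it is preserved there, too. -/
theorem iff_apply_of_forall_ne (S : Finset U) (hS : ∀ v, σ v ∈ S ↔ v ∈ S) (B : U → Prop) {e : U}
    (he : e ∈ S) (h : ∀ v ∈ S, v ≠ e → (B v ↔ B (σ v))) : B e ↔ B (σ e) := by
  classical
  -- σ permutes S, so B holds for as many v in S as for images of v in S; all terms but the one at e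
  -- cancel.
  have h1 : ∑ v ∈ S, (if B (σ v) then 1 else 0) = ∑ v ∈ S, (if B v then 1 else 0) :=
    Finset.sum_equiv σ (fun v => (hS v).symm) fun v _ => rfl
  rw [← Finset.add_sum_erase _ _ he, ← Finset.add_sum_erase _ (fun v => if B v then 1 else 0) he,
    Finset.sum_congr rfl fun v hv => by
      rw [← if_congr (h v (Finset.mem_of_mem_erase hv) (Finset.ne_of_mem_erase hv)) rfl rfl]] at h1
  by_cases h2 : B e <;> by_cases h3 : B (σ e) <;> simp_all

theorem of_sameCycle [Finite U] (B : U → Prop) (hB : ∀ v, B v → B (σ v)) (hr : B r) {x : U}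
    (hx : σ.SameCycle r x) : B x := by
  have h : ∀ k : ℕ, B ((σ ^ k) r) := fun k => by
    induction k with
    | zero => exact hr
    | succ k ih =>
      rw [pow_succ', Equiv.Perm.mul_apply]
      exact hB _ ih
  obtain ⟨k, rfl⟩ := hx.exists_nat_pow_eq
  exact h k

open Classical in
/-- The number of elements of the cycle of `r`. -/
noncomputable def cycleCard [Fintype U] (σ : Equiv.Perm U) (r : U) : ℕ :=
  (Finset.univ.filter fun x => σ.SameCycle r x).card

theorem cycleCard_eq [Fintype U] (σ : Equiv.Perm U) (r : U) [DecidablePred (σ.SameCycle r)] :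
    cycleCard σ r = (Finset.univ.filter fun x => σ.SameCycle r x).card := by
  unfold cycleCard
  congr

/-! ### Exchanges that enlarge the cycle of a fixed element -/

section Exchange

variable [DecidableEq U]

/-- Exchange of the images of `x` and `y`. -/
def exchange₁ (σ : Equiv.Perm U) (y x : U) : Equiv.Perm U := σ * Equiv.swap x y

/-- The element `σ p` is moved between `x` and `σ x`, and its place is taken by the cycle of `z`,
cut after `z`. -/
def exchange₂ (σ : Equiv.Perm U) (p x z : U) : Equiv.Perm U :=
  σ * (Equiv.swap x p * Equiv.swap p z * Equiv.swap z (σ p))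

theorem exchange₁_apply (y x v : U) :
    exchange₁ σ y x v = if v = x then σ y else if v = y then σ x else σ v := by
  simp only [exchange₁, Equiv.Perm.mul_apply, Equiv.swap_apply_def]
  split_ifs <;> rfl

theorem exchange₂_apply {p x z : U} (hpx : p ≠ x) (hpz : p ≠ z) (hxz : x ≠ z) (hqp : σ p ≠ p)
    (hqx : σ p ≠ x) (hqz : σ p ≠ z) (v : U) :
    exchange₂ σ p x z v = if v = z then σ (σ p) else if v = p then σ z else
      if v = σ p then σ x else if v = x then σ p else σ v := by
  simp only [exchange₂, Equiv.Perm.mul_apply]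
  by_cases h1 : v = z
  · subst h1
    rw [Equiv.swap_apply_left, Equiv.swap_apply_of_ne_of_ne hqp hqz,
      Equiv.swap_apply_of_ne_of_ne hqx hqp, if_pos rfl]
  by_cases h2 : v = p
  · subst h2
    rw [Equiv.swap_apply_of_ne_of_ne hpz hqp.symm, Equiv.swap_apply_left,
      Equiv.swap_apply_of_ne_of_ne hxz.symm hpz.symm, if_neg h1, if_pos rfl]
  by_cases h3 : v = σ p
  · rw [h3, Equiv.swap_apply_right, Equiv.swap_apply_right, Equiv.swap_apply_right, if_neg hqz,
      if_neg hqp, if_pos rfl]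
  rw [Equiv.swap_apply_of_ne_of_ne h1 h3, Equiv.swap_apply_of_ne_of_ne h2 h1, if_neg h1, if_neg h2,
    if_neg h3]
  by_cases h4 : v = x
  · rw [h4, Equiv.swap_apply_left, if_pos rfl]
  · rw [Equiv.swap_apply_of_ne_of_ne h4 h2, if_neg h4]

/-- Weight 1 is the largest possible, so the total cannot drop; it also certifies that the colours
at the ends of the new arcs differ. -/
theorem IsOptimal.exchange₁ [Fintype U] (hw : IsSemicompleteWeight w c) {y x : U} (h1 : w y (σ x) = 1)
    (h2 : w x (σ y) = 1) (hσ : IsOptimal w c σ) : IsOptimal w c (exchange₁ σ y x) := by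
  refine hσ.mono (fun v => ?_) (Finset.sum_le_sum fun v _ => ?_) <;> rw [exchange₁_apply] <;> split_ifs with h3 h4
  · exact hw.ne (h3 ▸ h2)
  · exact hw.ne (h4 ▸ h1)
  · exact hσ.1 v
  · subst h3; rw [h2]; exact hw.le_one _ _
  · subst h4; rw [h1]; exact hw.le_one _ _
  · exact le_rfl

theorem exchange₂_apply_of_sameCycle {p x z : U} (hσ : ∀ v, σ v ≠ v) (hp : σ.SameCycle r p)
    (hx : ¬ σ.SameCycle r x) (hz : ¬ σ.SameCycle r z) (hxz : x ≠ z) (v : U) :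
    exchange₂ σ p x z v = if v = z then σ (σ p) else if v = p then σ z else
      if v = σ p then σ x else if v = x then σ p else σ v := by
  have hq : σ.SameCycle r (σ p) := Equiv.Perm.sameCycle_apply_right.2 hp
  exact exchange₂_apply (by rintro rfl; exact hx hp) (by rintro rfl; exact hz hp) hxz (hσ p)
    (by rintro rfl; exact hx hq) (by rintro rfl; exact hz hq) v

theorem IsOptimal.exchange₂ [Fintype U] (hw : IsSemicompleteWeight w c) {p x z : U}
    (hp : σ.SameCycle r p) (hx : ¬ σ.SameCycle r x) (hz : ¬ σ.SameCycle r z) (hxz : x ≠ z)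
    (h1 : w x (σ p) = 1) (h2 : w (σ p) (σ x) = 1) (h3 : w p (σ z) = 1) (h4 : w z (σ (σ p)) = 1)
    (hσ : IsOptimal w c σ) : IsOptimal w c (exchange₂ σ p x z) := by
  refine hσ.mono (fun v => ?_) (Finset.sum_le_sum fun v _ => ?_) <;>
    rw [exchange₂_apply_of_sameCycle hσ.1.apply_ne hp hx hz hxz] <;> split_ifs with e1 e2 e3 e4
  · exact hw.ne (e1 ▸ h4)
  · exact hw.ne (e2 ▸ h3)
  · exact hw.ne (e3 ▸ h2)
  · exact hw.ne (e4 ▸ h1)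
  · exact hσ.1 v
  · subst e1; rw [h4]; exact hw.le_one _ _
  · subst e2; rw [h3]; exact hw.le_one _ _
  · rw [e3, h2]; exact hw.le_one _ _
  · subst e4; rw [h1]; exact hw.le_one _ _
  · exact le_rfl

/-- Two distinct cycles are cut, after y and after x, and joined crosswise. The proof follows
membership in the new cycle along σ: it can change only at y and x, and there the counting lemma
`iff_apply_of_forall_ne`, applied inside and outside the old cycle, excludes a change. -/
theorem cycleCard_exchange₁_lt [Fintype U] {y x : U} (hy : σ.SameCycle r y)
    (hx : ¬ σ.SameCycle r x) : cycleCard σ r < cycleCard (exchange₁ σ y x) r := by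
  classical
  set τ := exchange₁ σ y x with hτ
  have hτv : ∀ v, τ v = if v = x then σ y else if v = y then σ x else σ v := exchange₁_apply y x
  let B : U → Prop := fun v => τ.SameCycle r v
  have hB : ∀ v, B v ↔ B (τ v) := fun v => Equiv.Perm.sameCycle_apply_right.symm
  have hA : ∀ v, σ.SameCycle r (σ v) ↔ σ.SameCycle r v := fun v =>
    Equiv.Perm.sameCycle_apply_right
  have hyx : y ≠ x := fun h => hx (h ▸ hy)
  have hσB : ∀ v, v ≠ x → v ≠ y → (B v ↔ B (σ v)) := fun v h1 h2 => by
    have := hB v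
    rwa [hτv, if_neg h1, if_neg h2] at this
  have e1 : B y ↔ B (σ y) := iff_apply_of_forall_ne (Finset.univ.filter fun v => σ.SameCycle r v)
    (by simp) B (by simpa using hy) fun v hv hne => hσB v (by rintro rfl; simp_all) hne
  have e2 : B x ↔ B (σ x) := iff_apply_of_forall_ne (Finset.univ.filter fun v => ¬ σ.SameCycle r v)
    (by simp) B (by simpa using hx) fun v hv hne => hσB v hne (by rintro rfl; simp_all)
  have e3 : B x ↔ B (σ y) := by simpa [hτv] using hB x
  have hall : ∀ v, σ.SameCycle r v → B v := fun v hv => of_sameCycle B (fun v h => by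
    by_cases h1 : v = x
    · subst h1; exact e2.1 h
    by_cases h2 : v = y
    · subst h2; exact e1.1 h
    exact (hσB v h1 h2).1 h) (Equiv.Perm.SameCycle.refl _ _) hv
  rw [cycleCard_eq, cycleCard_eq]
  refine Finset.card_lt_card ⟨fun v hv => ?_, fun h => ?_⟩
  · simpa using hall v (by simpa using hv)
  · have : x ∈ Finset.univ.filter fun v => τ.SameCycle r v := by
      simpa using e3.2 (e1.1 (hall y hy))
    exact hx (by simpa using h this)

/-- At worst `σ p` is lost, while at least z and `σ z` are gained. If x lies on the cycle of z, then
`σ p` is not lost either. The assumption `σ p ≠ r` keeps r itself from being the displaced element.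
-/
theorem cycleCard_exchange₂_lt [Fintype U] {p x z : U} (hσ : ∀ v, σ v ≠ v) (hp : σ.SameCycle r p)
    (hx : ¬ σ.SameCycle r x) (hz : ¬ σ.SameCycle r z) (hxz : x ≠ z) (hq : σ p ≠ r) :
    cycleCard σ r < cycleCard (exchange₂ σ p x z) r := by
  classical
  set τ := exchange₂ σ p x z with hτ
  have hA : ∀ v, σ.SameCycle r (σ v) ↔ σ.SameCycle r v := fun v =>
    Equiv.Perm.sameCycle_apply_right
  have hq' : σ.SameCycle r (σ p) := (hA p).2 hp
  have hpx : p ≠ x := fun h => hx (h ▸ hp)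
  have hpz : p ≠ z := fun h => hz (h ▸ hp)
  have hqx : σ p ≠ x := fun h => hx (h ▸ hq')
  have hqz : σ p ≠ z := fun h => hz (h ▸ hq')
  have hqp : σ p ≠ p := hσ p
  have hτv := exchange₂_apply_of_sameCycle hσ hp hx hz hxz
  rw [← hτ] at hτv
  let B : U → Prop := fun v => τ.SameCycle r v
  have hB : ∀ v, B v ↔ B (τ v) := fun v => Equiv.Perm.sameCycle_apply_right.symm
  have hσB : ∀ v, v ≠ x → v ≠ z → v ≠ p → v ≠ σ p → (B v ↔ B (σ v)) := fun v h1 h2 h3 h4 => by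
    have := hB v
    rwa [hτv, if_neg h2, if_neg h3, if_neg h4, if_neg h1] at this
  have ez : B z ↔ B (σ (σ p)) := by simpa [hτv] using hB z
  have ep : B p ↔ B (σ z) := by simpa [hτv, hpz] using hB p
  have eq : B (σ p) ↔ B (σ x) := by simpa [hτv, hqz, hqp] using hB (σ p)
  have ex : B x ↔ B (σ p) := by simpa [hτv, hxz, hpx.symm, hqx.symm] using hB x
  -- Outside the old cycle both x and z have new images, but x is bridged by its detour through `σ
  -- p`, so z is the only exception.
  have ez' : B z ↔ B (σ z) := iff_apply_of_forall_ne (Finset.univ.filter fun v => ¬ σ.SameCycle r v)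
    (by simp) B (by simpa using hz) fun v hv hne => by
      by_cases h : v = x
      · subst h; exact ex.trans eq
      · rw [Finset.mem_filter] at hv
        exact hσB v h hne (fun e => hv.2 (e ▸ hp)) (fun e => hv.2 (e ▸ hq'))
  -- The old cycle is traversed from r. At `σ p`, which may have left the new cycle, the information
  -- carried along is that p belongs to it.
  have hall : ∀ v, σ.SameCycle r v → (v = σ p ∧ B p) ∨ (v ≠ σ p ∧ B v) := fun v hv => by
    refine (of_sameCycle (fun v => (v = σ p ∧ B p) ∨ (v ≠ σ p ∧ B v) ∨ ¬ σ.SameCycle r v) ?_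
      (Or.inr (Or.inl ⟨hq.symm, Equiv.Perm.SameCycle.refl _ _⟩)) hv).imp_right
        (Or.resolve_right · (not_not.2 hv))
    rintro v (⟨rfl, h⟩ | ⟨h1, h⟩ | h)
    · exact Or.inr (Or.inl ⟨hσ _, ez.1 (ez'.2 (ep.1 h))⟩)
    · by_cases hv : σ.SameCycle r v
      · by_cases hvp : v = p
        · subst hvp; exact Or.inl ⟨rfl, h⟩
        · exact Or.inr (Or.inl ⟨fun e => hvp (σ.injective e),
            (hσB v (by rintro rfl; exact hx hv) (by rintro rfl; exact hz hv) hvp h1).1 h⟩)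
      · exact Or.inr (Or.inr (by rwa [hA]))
    · exact Or.inr (Or.inr (by rwa [hA]))
  have hBp : B p := by simpa [hqp.symm] using hall p hp
  have hBz' : B (σ z) := ep.1 hBp
  have hz' : ¬ σ.SameCycle r (σ z) := by rwa [hA]
  have hsub : insert z (insert (σ z) ((Finset.univ.filter fun v => σ.SameCycle r v).erase (σ p))) ⊆
      Finset.univ.filter fun v => τ.SameCycle r v := by
    intro v hv
    simp only [Finset.mem_insert, Finset.mem_erase, Finset.mem_filter, Finset.mem_univ,
      true_and] at hv ⊢
    rcases hv with rfl | rfl | ⟨h1, h2⟩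
    · exact ez'.2 hBz'
    · exact hBz'
    · simpa [h1] using hall v h2
  have := Finset.card_le_card hsub
  rw [Finset.card_insert_of_notMem (by simp [hz, (hσ z).symm]),
    Finset.card_insert_of_notMem (by simp [hz']), Finset.card_erase_of_mem (by simpa using hq')] at this
  have hpos : 0 < (Finset.univ.filter fun v => σ.SameCycle r v).card :=
    Finset.card_pos.2 ⟨_, by simpa using hq'⟩
  rw [cycleCard_eq, cycleCard_eq]
  omega

end Exchange

/-! ### Existence of proper and of optimal permutations -/

/-- If no colour class contains more than half of the elements, then there is a proper permutation. -/
theorem exists_isProper [Fintype U] [DecidableEq κ] (c : U → κ)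
    (h : ∀ a, 2 * (Finset.univ.filter fun x => c x = a).card ≤ Fintype.card U) :
    ∃ σ : Equiv.Perm U, IsProper c σ := by
  classical
  obtain ⟨f, hf, hfc⟩ := (Finset.all_card_le_biUnion_card_iff_exists_injective
    fun x : U => Finset.univ.filter fun y => c x ≠ c y).1 fun S => by
      rcases S.eq_empty_or_nonempty with rfl | ⟨x, hx⟩
      · simp
      -- Hall's condition: a monochromatic S sees the complement of its class, which is at least
      -- half of everything; a set with two colours sees everything.
      by_cases hS : ∀ y ∈ S, c y = c x
      · have h1 : S.card ≤ (Finset.univ.filter fun y => c y = c x).card :=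
          Finset.card_le_card fun y hy => by simpa using hS y hy
        have h2 := Finset.card_filter_add_card_filter_not (s := Finset.univ) fun y => c y = c x
        have h3 : (Finset.univ.filter fun y => ¬ c y = c x).card ≤
            (S.biUnion fun x => Finset.univ.filter fun y => c x ≠ c y).card :=
          Finset.card_le_card fun y hy => by
            simp only [Finset.mem_biUnion, Finset.mem_filter, Finset.mem_univ, true_and] at hy ⊢
            exact ⟨x, hx, Ne.symm hy⟩
        have := h (c x)
        rw [Finset.card_univ] at h2
        omega
      · push Not at hS
        obtain ⟨y, hy, hxy⟩ := hS
        rw [show (S.biUnion fun x => Finset.univ.filter fun y => c x ≠ c y) = Finset.univ from ?_]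
        · exact Finset.card_le_univ _
        · refine Finset.eq_univ_of_forall fun z => ?_
          simp only [Finset.mem_biUnion, Finset.mem_filter, Finset.mem_univ, true_and]
          by_cases hz : c x = c z
          · exact ⟨y, hy, fun e => hxy (e.trans hz.symm)⟩
          · exact ⟨x, hx, hz⟩
  refine ⟨Equiv.ofBijective f hf.bijective_of_finite, fun x => ?_⟩
  simpa using hfc x

theorem exists_isOptimal [Fintype U] (w : U → U → ℕ) (h : ∃ σ : Equiv.Perm U, IsProper c σ) :
    ∃ σ : Equiv.Perm U, IsOptimal w c σ := by
  classical
  obtain ⟨σ, hσ, hmax⟩ := Finset.exists_max_image (Finset.univ.filter fun σ => IsProper c σ) (weight w)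
    (by obtain ⟨σ, hσ⟩ := h; exact ⟨σ, by simpa using hσ⟩)
  exact ⟨σ, by simpa using hσ, fun τ hτ => hmax τ (by simpa using hτ)⟩

end Weights

/-! ### Path-cycle factors and permutations of the vertex set with a universal vertex -/

section Lists

variable {U : Type*}

theorem map_fst_cycleArcs (l : List U) : (cycleArcs l).map Prod.fst = l :=
  List.map_fst_zip (by simp)

theorem map_snd_cycleArcs (l : List U) : (cycleArcs l).map Prod.snd = l.rotate 1 :=
  List.map_snd_zip (by simp)

theorem map_snd_flatten_cycleArcs_perm (ls : List (List U)) :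
    (((ls.map cycleArcs).flatten).map Prod.snd).Perm ls.flatten := by
  induction ls with
  | nil => simp
  | cons l ls ih =>
    simp only [List.map_cons, List.flatten_cons, List.map_append, map_snd_cycleArcs]
    exact (List.rotate_perm l 1).append ih

theorem map_fst_flatten_cycleArcs (ls : List (List U)) :
    ((ls.map cycleArcs).flatten).map Prod.fst = ls.flatten := by
  induction ls with
  | nil => simp
  | cons l ls ih =>
    simp only [List.map_cons, List.flatten_cons, List.map_append, map_fst_cycleArcs, ih]

/-- A list of disjoint cycles that covers everything is a permutation. -/
theorem exists_perm_of_cycles [Fintype U] (ls : List (List U)) (hnd : ls.flatten.Nodup)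
    (hall : ∀ u, u ∈ ls.flatten) :
    ∃ τ : Equiv.Perm U, (∀ u, (u, τ u) ∈ (ls.map cycleArcs).flatten) ∧
      ∀ f : U × U → ℕ, ((ls.map cycleArcs).flatten.map f).sum = ∑ u, f (u, τ u) := by
  classical
  set L := (ls.map cycleArcs).flatten with hL
  have h1 : (L.map Prod.fst).Nodup := by rwa [hL, map_fst_flatten_cycleArcs]
  have h2 : (L.map Prod.snd).Nodup := (map_snd_flatten_cycleArcs_perm ls).nodup_iff.2 hnd
  have h3 : ∀ u, ∃ v, (u, v) ∈ L := fun u => by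
    have : u ∈ L.map Prod.fst := by rw [hL, map_fst_flatten_cycleArcs]; exact hall u
    obtain ⟨⟨a, b⟩, hab, rfl⟩ := List.mem_map.1 this
    exact ⟨b, hab⟩
  choose g hg using h3
  have hinj : Function.Injective g := fun u v huv =>
    congrArg Prod.fst (List.inj_on_of_nodup_map h2 (hg u) (hg v) huv)
  refine ⟨Equiv.ofBijective g hinj.bijective_of_finite, hg, fun f => ?_⟩
  rw [← List.sum_toFinset f (List.Nodup.of_map _ h1)]
  refine (Finset.sum_bij (fun u _ => (u, g u)) (fun u _ => List.mem_toFinset.2 (hg u))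
    (fun u _ v _ h => congrArg Prod.fst h) (fun a ha => ⟨a.1, Finset.mem_univ _, ?_⟩)
    fun u _ => rfl).symm
  exact List.inj_on_of_nodup_map h1 (hg a.1) (List.mem_toFinset.1 ha) rfl

theorem pathArcs_ofFn {k : ℕ} (f : Fin k → U) :
    pathArcs (List.ofFn f) = List.ofFn fun i : Fin (k - 1) =>
      (f ⟨i, by omega⟩, f ⟨i + 1, by omega⟩) := by
  apply List.ext_getElem <;> simp [pathArcs]

end Lists

/-! ### Adjoining the universal vertex -/

section Factors

variable {V : Type*} {D : Digraph V}

/-- The costs of the arcs of the symmetric digraph of `D`, extended to a new vertex `none` such that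
all arcs to and from it have weight `1`. -/
noncomputable def extCost (D : Digraph V) : Option V → Option V → ℕ
  | none, none => 0
  | none, some _ => 1
  | some _, none => 1
  | some x, some y => arcCost D (x, y)

variable {p : ℕ} {c : V → Fin p}

theorem isSemicompleteWeight_extCost (hc : ∀ x y, (D.Adj x y ∨ D.Adj y x) ↔ c x ≠ c y) :
    IsSemicompleteWeight (extCost D) (Option.map c) where
  le_one x y := by
    rcases x with _ | x <;> rcases y with _ | y <;> simp only [extCost, arcCost] <;>
      (try split_ifs) <;> omega
  eq_zero x y h := by
    rcases x with _ | x <;> rcases y with _ | y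
    · rfl
    · simp at h
    · simp at h
    · have := mt (hc x y).1 (by simpa using h)
      exact if_neg fun h' => this (Or.inl h')
  one_le x y h := by
    rcases x with _ | x <;> rcases y with _ | y
    · simp at h
    · simp [extCost]
    · simp [extCost]
    · have := (hc x y).2 (by simpa using h)
      simp only [extCost, arcCost]
      rcases this with h | h <;> simp only [h, if_true] <;> omega

theorem extCost_none (D : Digraph V) (x : Option V) (hx : x ≠ none) :
    extCost D none x = 1 ∧ extCost D x none = 1 := by
  rcases x with _ | x
  · exact absurd rfl hx
  · exact ⟨rfl, rfl⟩

/-- Any vertex outside a fibre is joined to all of it, so maximality needs only that the fibre is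
non-empty, which surjectivity provides. -/
theorem isPartiteSet_fiber [Fintype V] (hsurj : Function.Surjective c)
    (hc : ∀ x y, (D.Adj x y ∨ D.Adj y x) ↔ c x ≠ c y) (a : Fin p) :
    IsPartiteSet D (Finset.univ.filter fun x => c x = a) := by
  refine ⟨fun x hx y hy h => (hc x y).1 (Or.inl h) ?_, fun T hT hle y hy => ?_⟩
  · simp_all
  · obtain ⟨x, rfl⟩ := hsurj a
    have hx : x ∈ T := hle (by simp)
    by_contra h
    have h' : c y ≠ c x := by simpa using h
    rcases (hc y x).2 h' with h | h
    · exact hT y hy x hx h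
    · exact hT x hx y hy h

theorem two_le_card [Fintype V] (hp : 2 ≤ p) (hsurj : Function.Surjective c) :
    2 ≤ Fintype.card V :=
  hp.trans (by simpa using Fintype.card_le_of_surjective c hsurj)

/-- The added vertex accounts for the summand 1 in the HP-majority inequality; its own class has one
element and is small enough because there are at least two vertices. -/
theorem exists_isProper_option [Fintype V] (hp : 2 ≤ p) (hsurj : Function.Surjective c)
    (hc : ∀ x y, (D.Adj x y ∨ D.Adj y x) ↔ c x ≠ c y) (hD : HPMajority D) :
    ∃ σ : Equiv.Perm (Option V), IsProper (Option.map c) σ := by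
  classical
  refine exists_isProper _ fun a => ?_
  rw [Fintype.card_option]
  rcases a with _ | a
  · have : (Finset.univ.filter fun x : Option V => Option.map c x = none).card = 1 := by
      rw [Finset.card_eq_one]
      exact ⟨none, by ext x; simp⟩
    have := two_le_card hp hsurj
    omega
  · have h := hD _ (isPartiteSet_fiber hsurj hc a)
    have : (Finset.univ.filter fun x : Option V => Option.map c x = some a) =
        (Finset.univ.filter fun x => c x = a).map Function.Embedding.some := by
      ext x
      rcases x with _ | x <;> simp
    rwa [this, Finset.card_map]

/-- The cycle through `none` that arises from a path. -/
theorem cycleArcs_none_cons (w : Option V → Option V → ℕ) (R : Option V → Option V → Prop)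
    (hw : ∀ x, w none (some x) = 1 ∧ w (some x) none = 1)
    (hR : ∀ x, R none (some x) ∧ R (some x) none) {l : List V} (hl : l ≠ [])
    (h : ∀ a ∈ pathArcs l, R (some a.1) (some a.2)) :
    ((cycleArcs (none :: l.map some)).map fun a => w a.1 a.2).sum =
        ((pathArcs l).map fun a => w (some a.1) (some a.2)).sum + 2 ∧
      ∀ a ∈ cycleArcs (none :: l.map some), R a.1 a.2 := by
  have key : ∀ (t : List V) (x : V), (∀ a ∈ pathArcs (x :: t), R (some a.1) (some a.2)) →
      ((((x :: t).map some).zip (t.map some ++ [none])).map fun a => w a.1 a.2).sum =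
        ((pathArcs (x :: t)).map fun a => w (some a.1) (some a.2)).sum + 1 ∧
      ∀ a ∈ ((x :: t).map some).zip (t.map some ++ [none]), R a.1 a.2 := by
    intro t
    induction t with
    | nil => intro x _; simp [pathArcs, hw, hR]
    | cons y t ih =>
      intro x hx
      have e : pathArcs (x :: y :: t) = (x, y) :: pathArcs (y :: t) := by simp [pathArcs]
      rw [e] at hx ⊢
      obtain ⟨h1, h2⟩ := ih y fun a ha => hx a (by simp [ha])
      simp only [List.map_cons, List.cons_append, List.zip_cons_cons, List.sum_cons] at h1 h2 ⊢
      refine ⟨by rw [h1, add_assoc], ?_⟩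
      intro a ha
      rcases List.mem_cons.1 ha with rfl | ha
      · exact hx (x, y) (by simp)
      · exact h2 a ha
  obtain ⟨x, t, rfl⟩ := List.exists_cons_of_ne_nil hl
  obtain ⟨h1, h2⟩ := key t x h
  have e : cycleArcs (none :: (x :: t).map some) =
      (none, some x) :: ((x :: t).map some).zip (t.map some ++ [none]) := by
    simp [cycleArcs, List.rotate_cons_succ]
  rw [e]
  refine ⟨?_, ?_⟩
  · rw [List.map_cons, List.sum_cons, h1, (hw x).1]
    omega
  · intro a ha
    rcases List.mem_cons.1 ha with rfl | ha
    · exact (hR x).1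
    · exact h2 a ha

theorem cycleArcs_map {U : Type*} (f : V → U) (l : List V) :
    cycleArcs (l.map f) = (cycleArcs l).map (Prod.map f f) := by
  rw [cycleArcs, ← List.map_rotate, List.zip_map, cycleArcs]

/-- A 1-path-cycle factor as a permutation. -/
theorem exists_perm_of_factor [Fintype V] (hc : ∀ x y, (D.Adj x y ∨ D.Adj y x) ↔ c x ≠ c y)
    (F : PathCycleFactor (symDigraph D)) :
    ∃ τ : Equiv.Perm (Option V), IsProper (Option.map c) τ ∧
      weight (extCost D) τ = factorCost D F + 2 := by
  obtain ⟨h1, h2⟩ := cycleArcs_none_cons (extCost D)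
    (fun x y => Option.map c x ≠ Option.map c y) (fun x => ⟨rfl, rfl⟩) (fun x => by simp)
    F.path_ne_nil fun a ha => by simpa using (hc _ _).1 (F.path_arcs_mem a ha)
  have hfl : ((none :: F.path.map some) :: F.cycles.map (List.map some)).flatten =
      none :: (F.path ++ F.cycles.flatten).map some := by
    simp [List.map_flatten]
  obtain ⟨τ, hτ, hsum⟩ := exists_perm_of_cycles
    ((none :: F.path.map some) :: F.cycles.map (List.map some))
    (by
      rw [hfl, List.nodup_cons]
      exact ⟨by simp, F.nodup.map (Option.some_injective V)⟩)
    (fun u => by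
      rw [hfl]
      rcases u with _ | u
      · simp
      · exact List.mem_cons_of_mem _ (List.mem_map_of_mem (F.spanning u)))
  refine ⟨τ, fun u => ?_, ?_⟩
  · have := hτ u
    rw [List.map_cons, List.flatten_cons, List.mem_append] at this
    rcases this with h | h
    · exact h2 _ h
    · obtain ⟨l, hl, hul⟩ := List.mem_flatten.1 h
      simp only [List.map_map, List.mem_map, Function.comp] at hl
      obtain ⟨m, hm, rfl⟩ := hl
      rw [cycleArcs_map] at hul
      obtain ⟨⟨a, b⟩, hab, e⟩ := List.mem_map.1 hul
      obtain ⟨rfl, e2⟩ : some a = u ∧ some b = τ u := by simpa using e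
      rw [← e2]
      simpa using (hc _ _).1 (F.cycle_arcs_mem m hm _ hab)
  · rw [weight, ← hsum fun a => extCost D a.1 a.2, List.map_cons, List.flatten_cons, List.map_append,
      List.sum_append, h1, factorCost, PathCycleFactor.arcs, List.map_append, List.sum_append]
    have : ((F.cycles.map (List.map some)).map cycleArcs).flatten.map
        (fun a => extCost D a.1 a.2) = ((F.cycles.map cycleArcs).flatten.map (arcCost D)) := by
      simp only [List.map_flatten, List.map_map]
      congr 2
      funext l
      simp only [Function.comp, cycleArcs_map, List.map_map]
      rfl
    rw [this]
    have e : (pathArcs F.path).map (fun a => extCost D (some a.1) (some a.2)) =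
        (pathArcs F.path).map (arcCost D) := rfl
    rw [e]
    omega

/-! ### Hamilton oriented paths as factors and as single cycles -/

namespace OrientedPath

/-- The path, listed in the other order. -/
def reverse {k : ℕ} (P : OrientedPath D k) : OrientedPath D k where
  vert i := P.vert i.rev
  vert_injective := P.vert_injective.comp Fin.rev_injective
  fwd i := !P.fwd i.rev
  arc_mem i := by
    have h := P.arc_mem i.rev
    have e1 : (⟨i, by omega⟩ : Fin k).rev = ⟨i.rev + 1, by have := i.rev.2; omega⟩ := by
      ext; simp only [Fin.val_rev]; omega
    have e2 : (⟨i + 1, by omega⟩ : Fin k).rev = ⟨i.rev, by have := i.rev.2; omega⟩ := by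
      ext; simp only [Fin.val_rev]; omega
    rw [e1, e2]
    cases hb : P.fwd i.rev <;> simp_all

theorem sigmaPlus_reverse {k : ℕ} (P : OrientedPath D k) : P.reverse.sigmaPlus = P.sigmaMinus := by
  refine Finset.card_equiv Fin.revPerm fun i => ?_
  simp [reverse]

theorem IsHamilton.reverse {k : ℕ} {P : OrientedPath D k} (h : P.IsHamilton) :
    P.reverse.IsHamilton :=
  h.comp Fin.rev_surjective

/-- The path serves as a factor without cycles. The inequality may be strict: a chosen backward arc
still costs 1 in the factor if D contains the opposite arc as well. -/
theorem IsHamilton.exists_sigmaPlus_le [Nonempty V] {k : ℕ} {P : OrientedPath D k}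
    (h : P.IsHamilton) :
    ∃ F : PathCycleFactor (symDigraph D), P.sigmaPlus ≤ factorCost D F := by
  have hk : k ≠ 0 := by
    rintro rfl
    obtain ⟨i, -⟩ := h (Classical.arbitrary V)
    exact i.elim0
  refine ⟨⟨List.ofFn P.vert, [], by simpa using hk, by simp, ?_, by simp, ?_, ?_⟩, ?_⟩
  · intro a ha
    rw [pathArcs_ofFn, List.mem_ofFn] at ha
    obtain ⟨i, rfl⟩ := ha
    have := P.arc_mem i
    split_ifs at this
    · exact Or.inl this
    · exact Or.inr this
  · simp [List.nodup_ofFn, P.vert_injective]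
  · intro v
    simpa using h v
  · simp only [factorCost, PathCycleFactor.arcs, List.map_nil, List.flatten_nil, List.append_nil,
      pathArcs_ofFn, List.map_ofFn, List.sum_ofFn, sigmaPlus, Finset.card_filter]
    refine Finset.sum_le_sum fun i _ => ?_
    have := P.arc_mem i
    split_ifs at this ⊢ with h
    · simp [arcCost, this]
    · simp

end OrientedPath

/-- A Hamilton oriented path whose number of forward arcs is at least the cost of each factor
attains both maxima. -/
theorem isGreatest_of_factorCost_le [Nonempty V] {k : ℕ} {P : OrientedPath D k}
    (hP : P.IsHamilton) (h : ∀ F, factorCost D F ≤ P.sigmaPlus) :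
    P.sigmaMax = P.sigmaPlus ∧ IsGreatest (hamiltonSigmaValues D) P.sigmaPlus ∧
      IsGreatest (factorCosts D) P.sigmaPlus := by
  have hle : ∀ (l : ℕ) (Q : OrientedPath D l), Q.IsHamilton → Q.sigmaMax ≤ P.sigmaPlus := by
    intro l Q hQ
    obtain ⟨F, hF⟩ := hQ.exists_sigmaPlus_le
    obtain ⟨G, hG⟩ := hQ.reverse.exists_sigmaPlus_le
    rw [Q.sigmaPlus_reverse] at hG
    exact max_le (hF.trans (h F)) (hG.trans (h G))
  have he : P.sigmaMax = P.sigmaPlus := le_antisymm (hle k P hP) (le_max_left _ _)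
  obtain ⟨F, hF⟩ := hP.exists_sigmaPlus_le
  refine ⟨he, ⟨⟨k, P, hP, he⟩, ?_⟩, ⟨F, le_antisymm (h F) hF⟩, ?_⟩
  · rintro _ ⟨l, Q, hQ, rfl⟩
    exact hle l Q hQ
  · rintro _ ⟨G, rfl⟩
    exact h G

/-- The cycle through the universal vertex is a Hamilton oriented path if it covers everything. -/
theorem exists_path_of_perm [Fintype V] {n : ℕ} (hV : Fintype.card V = n) (hn : 1 ≤ n)
    (hc : ∀ x y, (D.Adj x y ∨ D.Adj y x) ↔ c x ≠ c y) {σ : Equiv.Perm (Option V)}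
    (hσ : IsOptimal (extCost D) (Option.map c) σ) (hfull : ∀ x, σ.SameCycle none x) :
    ∃ P : OrientedPath D n, P.IsHamilton ∧ (∀ F, factorCost D F ≤ P.sigmaPlus) ∧
      (∀ i, some (P.vert i) = (σ ^ (i.val + 1)) none) ∧
      (∀ i, P.fwd i = true ↔ D.Adj (P.vert ⟨i, by omega⟩) (P.vert ⟨i + 1, by omega⟩)) ∧
      P.sigmaPlus + 2 = ∑ i ∈ Finset.range (n + 1),
        extCost D ((σ ^ i) none) ((σ ^ (i + 1)) none) := by
  classical
  have hcard : (Finset.univ : Finset (Option V)).card = n + 1 := by simp [hV]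
  have hcyc : σ.IsCycleOn ((Finset.univ : Finset (Option V)) : Set (Option V)) :=
    ⟨by simp, fun x _ y _ => (hfull x).symm.trans (hfull y)⟩
  -- the powers below `n + 1` enumerate all elements
  let f : Fin (n + 1) → Option V := fun i => (σ ^ i.val) none
  have hf : Function.Bijective f := by
    rw [Fintype.bijective_iff_surjective_and_card]
    refine ⟨fun x => ?_, by simp [hV]⟩
    obtain ⟨i, hi, h⟩ := hcyc.exists_pow_eq (Finset.mem_univ none) (Finset.mem_univ x)
    exact ⟨⟨i, hcard ▸ hi⟩, h⟩
  have hlast : (σ ^ (n + 1)) none = none := by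
    rw [← hcard]
    exact hcyc.pow_card_apply (Finset.mem_univ none)
  have hex : ∀ i : Fin n, ∃ v, some v = f i.succ := fun i => by
    have : f i.succ ≠ f 0 := hf.1.ne (Fin.succ_ne_zero i)
    exact (Option.ne_none_iff_exists.1 this)
  choose vert hvert using hex
  have hval : ∀ i : Fin n, some (vert i) = (σ ^ (i.val + 1)) none := hvert
  have hstep : ∀ i : Fin (n - 1), some (vert ⟨i + 1, by omega⟩) = σ (some (vert ⟨i, by omega⟩)) := by
    intro i
    rw [hval, hval, pow_succ', Equiv.Perm.mul_apply]
  let P : OrientedPath D n :=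
    { vert := vert
      vert_injective := fun i j hij => by
        have := hf.1 ((hvert i).symm.trans ((congrArg some hij).trans (hvert j)))
        exact Fin.succ_injective _ this
      -- A pair joined in both directions is oriented forward, so an arc is forward exactly if its
      -- cost is 1.
      fwd := fun i => decide (D.Adj (vert ⟨i, by omega⟩) (vert ⟨i + 1, by omega⟩))
      arc_mem := fun i => by
        have h1 := hσ.1 (some (vert ⟨i, by omega⟩))
        rw [← hstep i] at h1
        have h2 := (hc _ _).2 (fun h => h1 (congrArg some h))
        by_cases h : D.Adj (vert ⟨i, by omega⟩) (vert ⟨i + 1, by omega⟩)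
        · simp [h]
        · simpa [h] using h2 }
  have hsum : P.sigmaPlus + 2 = ∑ i ∈ Finset.range (n + 1),
      extCost D ((σ ^ i) none) ((σ ^ (i + 1)) none) := by
    obtain ⟨m, rfl⟩ : ∃ m, n = m + 1 := ⟨n - 1, by omega⟩
    have e1 : extCost D ((σ ^ 0) none) ((σ ^ (0 + 1)) none) = 1 := by
      have h := hval ⟨0, by omega⟩
      simp only at h
      rw [← h]; rfl
    have e2 : extCost D ((σ ^ (m + 1)) none) ((σ ^ (m + 1 + 1)) none) = 1 := by
      rw [hlast, ← hval ⟨m, by omega⟩]; rfl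
    -- The first and the last term belong to the two arcs at `none`; they are the 2 on the other
    -- side.
    rw [Finset.sum_range_succ, e2, Finset.sum_range_succ', e1, Finset.sum_range,
      OrientedPath.sigmaPlus, Finset.card_filter]
    rw [add_assoc]
    congr 1
    refine Finset.sum_congr rfl fun i _ => ?_
    have h1 := hval ⟨i, by omega⟩
    have h2 := hval ⟨i + 1, by omega⟩
    simp only at h1 h2
    rw [← h1, ← h2]
    simp [P, extCost, arcCost]
  refine ⟨P, fun v => ?_, fun F => ?_, hval, fun i => by simp [P], hsum⟩
  · obtain ⟨i, hi⟩ := hf.2 (some v)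
    have hi0 : i ≠ 0 := by
      rintro rfl
      simp [f] at hi
    obtain ⟨j, rfl⟩ := Fin.exists_succ_eq.2 hi0
    exact ⟨j, Option.some_injective _ ((hvert j).trans hi)⟩
  · obtain ⟨τ, hτ, hw⟩ := exists_perm_of_factor hc F
    have h1 := hσ.2 τ hτ
    have h2 : weight (extCost D) σ = P.sigmaPlus + 2 := by
      rw [hsum, Finset.sum_range, weight, ← (Equiv.ofBijective f hf).sum_comp]
      simp [f, pow_succ', Equiv.Perm.mul_apply]
    omega

/-- Among the optimal permutations there is one that has only one cycle. -/
theorem exists_isOptimal_sameCycle [Fintype V]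
    (hc : ∀ x y, (D.Adj x y ∨ D.Adj y x) ↔ c x ≠ c y)
    (h : ∃ σ : Equiv.Perm (Option V), IsProper (Option.map c) σ) :
    ∃ σ, IsOptimal (extCost D) (Option.map c) σ ∧ ∀ x, σ.SameCycle none x := by
  classical
  have hw := isSemicompleteWeight_extCost hc
  obtain ⟨σ₀, hσ₀⟩ := exists_isOptimal (extCost D) h
  -- An optimal permutation with the largest cycle through `none` admits no exchange.
  obtain ⟨σ, hσ, hmax⟩ := Finset.exists_max_image
    (Finset.univ.filter fun σ => IsOptimal (extCost D) (Option.map c) σ)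
    (fun σ => cycleCard σ none) ⟨σ₀, by simpa using hσ₀⟩
  have hσ : IsOptimal (extCost D) (Option.map c) σ := by simpa using hσ
  refine ⟨σ, hσ, sameCycle_of_no_exchange hw (extCost_none D) hσ.1 ?_ ?_⟩
  · rintro y x hy hx ⟨h1, h2⟩
    exact (cycleCard_exchange₁_lt hy hx).not_ge (hmax _ (by simpa using hσ.exchange₁ hw h1 h2))
  · rintro p x z hp hx hz hxz hq ⟨h1, h2, h3, h4⟩
    exact (cycleCard_exchange₂_lt hσ.1.apply_ne hp hx hz hxz hq).not_ge
      (hmax _ (by simpa using hσ.exchange₂ hw hp hx hz hxz h1 h2 h3 h4))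

theorem exists_isGreatest [Fintype V] (hD : IsSemicompleteMultipartite D) (hm : HPMajority D) :
    ∃ m : ℕ, IsGreatest (hamiltonSigmaValues D) m ∧ IsGreatest (factorCosts D) m := by
  obtain ⟨p, c, hp, hsurj, hc⟩ := hD
  have h2 := two_le_card hp hsurj
  have : Nonempty V := Fintype.card_pos_iff.1 (by omega)
  obtain ⟨σ, hσ, hfull⟩ := exists_isOptimal_sameCycle hc (exists_isProper_option hp hsurj hc hm)
  obtain ⟨P, hP, hF, -⟩ := exists_path_of_perm rfl (by omega) hc hσ hfull
  exact ⟨_, (isGreatest_of_factorCost_le hP hF).2⟩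

end Factors

/-! ### Programs with bounded loops -/

namespace RAM

/-- Programs in which all loops run a counter up to the value of a variable. -/
inductive LoopProg : Type
  | skip
  | assign (x : ℕ) (e : Expr)
  | store (a : ℕ) (i j e : Expr)
  | seq (c d : LoopProg)
  | ite (e : Expr) (c d : LoopProg)
  | loop (x m : ℕ) (c : LoopProg)

namespace LoopProg

/-- Translation into `while`-programs. -/
def compile : LoopProg → Prog
  | skip => .skip
  | assign x e => .assign x e
  | store a i j e => .store a i j e
  | seq c d => .seq c.compile d.compile
  | ite e c d => .ite e c.compile d.compile
  | loop x m c => .seq (.assign x (.lit 0))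
      (.while (.lt (.var x) (.var m)) (.seq c.compile (.assign x (.add (.var x) (.lit 1)))))

/-- A bound for the running time, as a polynomial in a common bound for all loop counters. -/
noncomputable def cost : LoopProg → Polynomial ℕ
  | skip => 1
  | assign _ e => (e.size + 1 : ℕ)
  | store _ i j e => (i.size + j.size + e.size + 1 : ℕ)
  | seq c d => c.cost + d.cost
  | ite e c d => (e.size + 1 : ℕ) + (c.cost + d.cost)
  | loop _ _ c => Polynomial.X * (c.cost + 8) + 6

/-- The variables that may be changed. -/
def vars : LoopProg → List ℕ
  | skip => []
  | assign x _ => [x]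
  | store _ _ _ _ => []
  | seq c d => c.vars ++ d.vars
  | ite _ c d => c.vars ++ d.vars
  | loop x _ c => x :: c.vars

/-- The arrays that may be changed. -/
def arrs : LoopProg → List ℕ
  | skip => []
  | assign _ _ => []
  | store a _ _ _ => [a]
  | seq c d => c.arrs ++ d.arrs
  | ite _ c d => c.arrs ++ d.arrs
  | loop _ _ c => c.arrs

/-- The states agree on everything that `c` does not change. -/
structure Frame (c : LoopProg) (s s' : State) : Prop where
  var : ∀ x, x ∉ c.vars → s'.var x = s.var x
  arr : ∀ a, a ∉ c.arrs → s'.arr a = s.arr a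

theorem Frame.refl (c : LoopProg) (s : State) : Frame c s s := ⟨fun _ _ => rfl, fun _ _ => rfl⟩

theorem Frame.trans {b c d : LoopProg} {s s' s'' : State} (h : Frame b s s') (h' : Frame c s' s'')
    (hbv : b.vars ⊆ d.vars) (hba : b.arrs ⊆ d.arrs) (hcv : c.vars ⊆ d.vars)
    (hca : c.arrs ⊆ d.arrs) : Frame d s s'' where
  var x hx := (h'.var x fun h => hx (hcv h)).trans (h.var x fun h => hx (hbv h))
  arr a ha := (h'.arr a fun h => ha (hca h)).trans (h.arr a fun h => ha (hba h))

/-- Started in the state `s`, the program `c` halts in a state with the property `Q`, within the time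
given by `cost`, and respects its frame. -/
def Runs (K : ℕ) (c : LoopProg) (s : State) (Q : State → Prop) : Prop :=
  ∃ t s', Exec c.compile s t s' ∧ t ≤ c.cost.eval K ∧ Frame c s s' ∧ Q s'

variable {K : ℕ} {s : State} {Q R : State → Prop} {c d : LoopProg}

theorem Runs.mono (h : Runs K c s R) (hRQ : ∀ s', Frame c s s' → R s' → Q s') : Runs K c s Q := by
  obtain ⟨t, s', h1, h2, h3, h4⟩ := h
  exact ⟨t, s', h1, h2, h3, hRQ s' h3 h4⟩

theorem Runs.skip (h : Q s) : Runs K .skip s Q :=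
  ⟨1, s, .skip s, by simp [cost], .refl _ _, h⟩

theorem Runs.assign {x : ℕ} {e : Expr} (h : Q (s.setVar x (e.eval s))) :
    Runs K (.assign x e) s Q :=
  ⟨_, _, .assign s x e, by simp [cost], ⟨fun y hy => if_neg (by simpa [vars] using hy),
    fun _ _ => rfl⟩, h⟩

theorem Runs.store {a : ℕ} {i j e : Expr} (h : Q (s.setArr a (i.eval s) (j.eval s) (e.eval s))) :
    Runs K (.store a i j e) s Q :=
  ⟨_, _, .store s a i j e, by simp [cost], ⟨fun _ _ => rfl, fun b hb => by
    funext k l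
    exact if_neg fun h => hb (by simp [arrs, h.1])⟩, h⟩

theorem Runs.seq (h : Runs K c s R) (h' : ∀ s', Frame c s s' → R s' → Runs K d s' Q) :
    Runs K (.seq c d) s Q := by
  obtain ⟨t, s', h1, h2, h3, h4⟩ := h
  obtain ⟨u, s'', h5, h6, h7, h8⟩ := h' s' h3 h4
  exact ⟨_, _, .seq h1 h5, by simpa [cost] using Nat.add_le_add h2 h6,
    h3.trans h7 (by simp [vars]) (by simp [arrs]) (by simp [vars]) (by simp [arrs]), h8⟩

theorem Runs.assign_seq {x : ℕ} {e : Expr} (h : Runs K d (s.setVar x (e.eval s)) Q) :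
    Runs K (.seq (.assign x e) d) s Q :=
  Runs.seq (R := (· = s.setVar x (e.eval s))) (.assign rfl) fun _ _ hs => hs ▸ h

theorem Runs.store_seq {a : ℕ} {i j e : Expr}
    (h : Runs K d (s.setArr a (i.eval s) (j.eval s) (e.eval s)) Q) :
    Runs K (.seq (.store a i j e) d) s Q :=
  Runs.seq (R := (· = s.setArr a (i.eval s) (j.eval s) (e.eval s))) (.store rfl)
    fun _ _ hs => hs ▸ h

theorem Runs.ite {e : Expr} (h1 : e.eval s ≠ 0 → Runs K c s Q) (h0 : e.eval s = 0 → Runs K d s Q) :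
    Runs K (.ite e c d) s Q := by
  by_cases he : e.eval s = 0
  · obtain ⟨t, s', h2, h3, h4, h5⟩ := h0 he
    refine ⟨_, _, .ite_false he h2, ?_, h4.trans (.refl c _) (by simp [vars]) (by simp [arrs])
      (by simp [vars]) (by simp [arrs]), h5⟩
    simp only [cost, Polynomial.eval_add, Polynomial.eval_natCast, Nat.cast_id]
    omega
  · obtain ⟨t, s', h2, h3, h4, h5⟩ := h1 he
    refine ⟨_, _, .ite_true he h2, ?_, h4.trans (.refl c _) (by simp [vars]) (by simp [arrs])
      (by simp [vars]) (by simp [arrs]), h5⟩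
    simp only [cost, Polynomial.eval_add, Polynomial.eval_natCast, Nat.cast_id]
    omega

/-- The rule for loops; `I i` holds before the round with counter value `i`. -/
theorem Runs.loop {x m : ℕ} (I : ℕ → State → Prop) (M : ℕ) (hM : s.var m = M) (hK : M ≤ K)
    (hx : x ∉ c.vars) (hm : m ∉ c.vars) (hmx : m ≠ x) (h0 : I 0 (s.setVar x 0))
    (hstep : ∀ i s', i < M → Frame (.loop x m c) s s' → s'.var x = i → I i s' →
      Runs K c s' fun s'' => I (i + 1) (s''.setVar x (i + 1)))
    (hQ : ∀ s', Frame (.loop x m c) s s' → I M s' → Q s') : Runs K (.loop x m c) s Q := by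
  -- Here k counts the remaining rounds. Each costs 8 steps besides the body, 4 for the test and 4
  -- for the increment; the final failing test costs another 4.
  have key : ∀ k i s₁, i + k = M → Frame (.loop x m c) s s₁ → s₁.var x = i → I i s₁ →
      ∃ t s', Exec (.while (.lt (.var x) (.var m))
        (.seq c.compile (.assign x (.add (.var x) (.lit 1))))) s₁ t s' ∧
        t ≤ k * (c.cost.eval K + 8) + 4 ∧ Frame (.loop x m c) s s' ∧ I M s' := by
    intro k
    induction k with
    | zero =>
      intro i s₁ hi hf hxi hI
      obtain rfl : i = M := by omega
      have hme : s₁.var m = i := (hf.var m (by simp [vars, hmx, hm])).trans hM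
      exact ⟨_, s₁, .while_false (by simp [Expr.eval, hme, hxi]), by simp [Expr.size], hf, hI⟩
    | succ k ih =>
      intro i s₁ hi hf hxi hI
      have hme : s₁.var m = M := (hf.var m (by simp [vars, hmx, hm])).trans hM
      obtain ⟨t, s₂, h1, h2, h3, h4⟩ := hstep i s₁ (by omega) hf hxi hI
      have hx2 : s₂.var x = i := (h3.var x hx).trans hxi
      have h5 : Exec (.assign x (.add (.var x) (.lit 1))) s₂ 4 (s₂.setVar x (i + 1)) := by
        have := Exec.assign s₂ x (.add (.var x) (.lit 1))
        simpa [Expr.eval, Expr.size, hx2] using this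
      have hf' : Frame (.loop x m c) s (s₂.setVar x (i + 1)) := by
        have := hf.trans h3 (d := .loop x m c) (by simp) (by simp) (by simp [vars]) (by simp [arrs])
        exact ⟨fun y hy => (if_neg fun h => hy (by simp [vars, h])).trans (this.var y hy), this.arr⟩
      obtain ⟨u, s₃, h6, h7, h8, h9⟩ := ih (i + 1) (s₂.setVar x (i + 1)) (by omega) hf'
        (by simp [State.setVar]) h4
      refine ⟨_, s₃, .while_true ?_ (.seq h1 h5) h6, ?_, h8, h9⟩
      · have : i < M := by omega
        simp [Expr.eval, hxi, hme, this]
      · have : (Expr.lt (.var x) (.var m)).size = 3 := rfl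
        rw [this, add_one_mul]
        omega
  obtain ⟨t, s', h1, h2, h3, h4⟩ := key M 0 (s.setVar x 0) (by omega)
    ⟨fun y hy => if_neg fun h => hy (by simp [vars, h]), fun _ _ => rfl⟩
    (by simp [State.setVar]) h0
  refine ⟨_, s', .seq (.assign s x (.lit 0)) h1, ?_, h3, hQ s' h3 h4⟩
  have h5 := Nat.mul_le_mul_right (c.cost.eval K + 8) hK
  have h6 : (Expr.lit 0).size = 1 := rfl
  simp only [cost, Polynomial.eval_add, Polynomial.eval_mul, Polynomial.eval_X,
    Polynomial.eval_ofNat, h6]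
  omega

end LoopProg

@[simp] theorem State.setVar_var (s : State) (x v y : ℕ) :
    (s.setVar x v).var y = if y = x then v else s.var y := rfl

@[simp] theorem State.setVar_arr (s : State) (x v : ℕ) : (s.setVar x v).arr = s.arr := rfl

@[simp] theorem State.setArr_var (s : State) (a i j v : ℕ) : (s.setArr a i j v).var = s.var := rfl

@[simp] theorem State.setArr_arr (s : State) (a i j v b k l : ℕ) :
    (s.setArr a i j v).arr b k l = if b = a ∧ k = i ∧ l = j then v else s.arr b k l := rfl

end RAM

/-! ### The auction algorithm for the assignment problem -/

section Auction

variable {U κ : Type*} {W : U → U → ℕ} {B : ℕ} {f : U → Option U} {p : U → ℕ}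

/-- The invariant of the auction: the bidders `x` own the distinct objects `f x`, objects without an
owner have price `0`, and no owner would gain more than `1` by switching to another object. -/
structure IsAuction (W : U → U → ℕ) (B : ℕ) (f : U → Option U) (p : U → ℕ) : Prop where
  inj : ∀ x x' y, f x = some y → f x' = some y → x = x'
  unsold : ∀ y, (∀ x, f x ≠ some y) → p y = 0
  slack : ∀ x y, f x = some y → ∀ z, W x z + p y ≤ W x y + p z + 1
  le : ∀ y, p y ≤ B + 1

theorem IsAuction.init (W : U → U → ℕ) (B : ℕ) : IsAuction W B (fun _ => none) fun _ => 0 :=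
  ⟨by simp, by simp, by simp, by simp⟩

variable [Fintype U]

/-- Some object has no owner if some bidder owns nothing. -/
theorem exists_forall_ne_some {f : U → Option U} {x₀ : U} (hx₀ : f x₀ = none) :
    ∃ y, ∀ x, f x ≠ some y := by
  by_contra hcon
  push Not at hcon
  choose g hg using hcon
  have hg' : Function.Injective g := fun y z hyz =>
    Option.some_injective _ ((hg y).symm.trans ((congrArg f hyz).trans (hg z)))
  obtain ⟨y, rfl⟩ := (Finite.injective_iff_surjective.1 hg') x₀
  simp [hg] at hx₀

/-- If everybody owns something, then the assignment is optimal up to the number of bidders. -/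
theorem IsAuction.exists_perm (h : IsAuction W B f p) (hf : ∀ x, f x ≠ none) :
    ∃ σ : Equiv.Perm U, (∀ x, f x = some (σ x)) ∧
      ∀ τ : Equiv.Perm U, ∑ x, W x (τ x) ≤ ∑ x, W x (σ x) + Fintype.card U := by
  choose g hg using fun x => Option.ne_none_iff_exists'.1 (hf x)
  have hinj : Function.Injective g := fun x x' hx => h.inj x x' (g x) (hg x) (by rw [hg, hx])
  refine ⟨Equiv.ofBijective g hinj.bijective_of_finite, hg, fun τ => ?_⟩
  -- In the sum of the slack conditions the prices cancel, as both assignments use every object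
  -- once; one unit per bidder remains.
  have h1 : ∑ x, (W x (τ x) + p (g x)) ≤ ∑ x, (W x (g x) + p (τ x) + 1) :=
    Finset.sum_le_sum fun x _ => h.slack x (g x) (hg x) (τ x)
  have h2 : ∑ x, p (τ x) = ∑ x, p x := Equiv.sum_comp τ p
  have h3 : ∑ x, p (g x) = ∑ x, p x := Equiv.sum_comp (Equiv.ofBijective g hinj.bijective_of_finite) p
  simp only [Finset.sum_add_distrib, Finset.sum_const, Finset.card_univ, smul_eq_mul, mul_one, h2,
    h3] at h1
  simp only [Equiv.ofBijective_apply]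
  omega

/-- The weights for the auction: multiples of `N + 1` that make the proper permutations of maximum
weight optimal. -/
def bidWeight (w : U → U → ℕ) (N : ℕ) (x y : U) : ℕ :=
  if w x y = 1 then N * (N + 1) + (N + 1) else if w y x = 1 then N * (N + 1) else 0

/-- A proper permutation has total (N + 1)(N² + weight), whereas one with an improper arc reaches at
most (N - 1)(N + 1)² = (N + 1)(N² - 1). This gap, and that between two proper permutations of
different weight, is at least N + 1 and so exceeds the tolerance N. -/
theorem isOptimal_of_bidWeight {w : U → U → ℕ} {c : U → κ} (hw : IsSemicompleteWeight w c)
    (hex : ∃ σ : Equiv.Perm U, IsProper c σ) {σ : Equiv.Perm U}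
    (h : ∀ τ : Equiv.Perm U, ∑ x, bidWeight w (Fintype.card U) x (τ x) ≤
      ∑ x, bidWeight w (Fintype.card U) x (σ x) + Fintype.card U) : IsOptimal w c σ := by
  set N := Fintype.card U with hN
  have heq : ∀ x y, c x ≠ c y → bidWeight w N x y = (N + 1) * (N + w x y) := fun x y hxy => by
    have h1 := hw.le_one x y
    rcases Nat.le_one_iff_eq_zero_or_eq_one.1 h1 with h2 | h2
    · have h3 := hw.eq_one hxy (by omega)
      simp only [bidWeight, h2, h3]
      simp [mul_comm]
    · simp only [bidWeight, h2, if_true]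
      ring
  have hle : ∀ x y, bidWeight w N x y ≤ (N + 1) * (N + 1) := fun x y => by
    unfold bidWeight
    split_ifs <;> nlinarith
  have hprop : ∀ τ, IsProper c τ →
      ∑ x, bidWeight w N x (τ x) = (N + 1) * (N * N + weight w τ) := fun τ hτ => by
    rw [Finset.sum_congr rfl fun x _ => heq x (τ x) (hτ x), ← Finset.mul_sum,
      Finset.sum_add_distrib, weight]
    simp [hN]
  have hσ : IsProper c σ := by
    by_contra hcon
    simp only [IsProper, not_forall, not_not] at hcon
    obtain ⟨x₀, hx₀⟩ := hcon
    obtain ⟨τ, hτ⟩ := hex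
    have h1 := h τ
    classical
    rw [hprop τ hτ, ← Finset.add_sum_erase _ _ (Finset.mem_univ x₀)] at h1
    have h2 : bidWeight w N x₀ (σ x₀) = 0 := by
      simp [bidWeight, hw.eq_zero _ _ hx₀, hw.eq_zero _ _ hx₀.symm]
    have h3 : ∑ x ∈ Finset.univ.erase x₀, bidWeight w N x (σ x) ≤ (N - 1) * ((N + 1) * (N + 1)) := by
      refine (Finset.sum_le_card_nsmul _ _ _ fun x _ => hle x (σ x)).trans ?_
      rw [Finset.card_erase_of_mem (Finset.mem_univ x₀), Finset.card_univ, smul_eq_mul]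
    have hpos : 1 ≤ N := Fintype.card_pos_iff.2 ⟨x₀⟩
    obtain ⟨m, hm⟩ : ∃ m, N = m + 1 := ⟨N - 1, by omega⟩
    rw [h2] at h1
    rw [hm] at h1 h3
    simp only [Nat.add_sub_cancel] at h3
    nlinarith [Nat.zero_le (weight w τ)]
  refine ⟨hσ, fun τ hτ => ?_⟩
  have h1 := h τ
  rw [hprop τ hτ, hprop σ hσ] at h1
  by_contra hlt
  nlinarith

variable [DecidableEq U]

/-- The object was a best one for the new owner, so a price increase of 1 leaves it within 1 of the
best; the slack of other owners only improves. -/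
theorem IsAuction.bid (h : IsAuction W B f p) (hW : ∀ x y, W x y ≤ B) {x₀ y₀ : U} (hx₀ : f x₀ = none)
    (hbest : ∀ z, W x₀ z + p y₀ ≤ W x₀ y₀ + p z) :
    IsAuction W B (fun x => if x = x₀ then some y₀ else if f x = some y₀ then none else f x)
      fun y => if y = y₀ then p y + 1 else p y := by
  refine ⟨fun x x' y h1 h2 => ?_, fun y hy => ?_, fun x y hxy z => ?_, fun y => ?_⟩
  · split_ifs at h1 h2 with h3 h4 h5 h6 h7
    · rw [h3, h4]
    · exact absurd (h2.trans h1.symm) h5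
    · exact absurd (h1.trans h2.symm) h6
    · exact h.inj x x' y h1 h2
  · have h1 : y ≠ y₀ := by
      rintro rfl
      exact hy x₀ (by simp)
    rw [if_neg h1]
    refine h.unsold y fun x hx => hy x ?_
    have h2 : x ≠ x₀ := by
      rintro rfl
      simp [hx] at hx₀
    have h3 : f x ≠ some y₀ := fun h' => h1 (Option.some_injective _ (hx.symm.trans h'))
    rw [if_neg h2, if_neg h3, hx]
  · split_ifs at hxy with h1 h2
    · obtain rfl : y₀ = y := Option.some_injective _ hxy
      subst h1
      have := hbest z
      rw [if_pos rfl]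
      split_ifs <;> omega
    · have h3 : y ≠ y₀ := by
        rintro rfl
        exact h2 hxy
      have := h.slack x y hxy z
      rw [if_neg h3]
      split_ifs <;> omega
  · split_ifs with h1
    -- As `x₀` owns nothing, some object z is unsold and has price 0. Since `y₀` is at least as
    -- attractive as z, its price before the bid is at most `W x₀ y₀`.
    · obtain ⟨z, hz⟩ := exists_forall_ne_some hx₀
      have h2 := hbest z
      have h3 := h.unsold z hz
      have h4 := hW x₀ y₀
      subst h1
      omega
    · exact h.le y

theorem sum_bid (p : U → ℕ) (y₀ : U) : ∑ y, (if y = y₀ then p y + 1 else p y) = ∑ y, p y + 1 := by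
  have : ∀ y, (if y = y₀ then p y + 1 else p y) = p y + if y = y₀ then 1 else 0 := fun y => by
    split_ifs <;> rfl
  simp only [this, Finset.sum_add_distrib, Finset.sum_ite_eq', Finset.mem_univ, if_true]

end Auction

/-! ### The program: weights and auction -/

/-- The number that represents a vertex; the universal vertex is represented by `n`. -/
def enc {n : ℕ} : Option (Fin n) → ℕ
  | none => n
  | some i => i

theorem enc_none {n : ℕ} : enc (none : Option (Fin n)) = n := rfl

theorem enc_lt {n : ℕ} (x : Option (Fin n)) : enc x < n + 1 := by
  rcases x with _ | i
  · exact Nat.lt_succ_self n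
  · exact i.2.trans (Nat.lt_succ_self n)

theorem enc_injective {n : ℕ} : Function.Injective (enc : Option (Fin n) → ℕ) := by
  rintro (_ | i) (_ | j) h
  · rfl
  · exact absurd h j.2.ne'
  · exact absurd h i.2.ne
  · exact congrArg some (Fin.ext h)

theorem enc_inj {n : ℕ} {x y : Option (Fin n)} : enc x = enc y ↔ x = y := enc_injective.eq_iff

theorem exists_enc {n k : ℕ} (hk : k < n + 1) : ∃ x : Option (Fin n), enc x = k := by
  by_cases h : k < n
  · exact ⟨some ⟨k, h⟩, rfl⟩
  · exact ⟨none, by simp only [enc]; omega⟩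

/-- The number that represents the owned object, if any. -/
def encOption {n : ℕ} : Option (Option (Fin n)) → ℕ
  | none => 0
  | some x => enc x + 1

theorem encOption_eq_zero {n : ℕ} {x : Option (Option (Fin n))} : encOption x = 0 ↔ x = none := by
  rcases x with _ | x <;> simp [encOption]

theorem encOption_eq_succ {n : ℕ} {x : Option (Option (Fin n))} {y : Option (Fin n)} :
    encOption x = enc y + 1 ↔ x = some y := by
  rcases x with _ | x <;> simp [encOption, enc_inj]

namespace RAM

open LoopProg

/-- Variable `0` holds `n`, variable `2` holds `n + 1`, and array `0` holds the weights `w`. -/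
structure HoldsWeights {n : ℕ} (w : Option (Fin n) → Option (Fin n) → ℕ) (s : State) : Prop where
  var_zero : s.var 0 = n
  var_two : s.var 2 = n + 1
  arr : ∀ x y, s.arr 0 (enc x) (enc y) = w x y

theorem HoldsWeights.of_frame {n : ℕ} {w : Option (Fin n) → Option (Fin n) → ℕ} {c : LoopProg}
    {s s' : State} (h : HoldsWeights w s) (hf : Frame c s s') (h0 : 0 ∉ c.vars) (h2 : 2 ∉ c.vars)
    (ha : 0 ∉ c.arrs) : HoldsWeights w s' :=
  ⟨(hf.var 0 h0).trans h.var_zero, (hf.var 2 h2).trans h.var_two, by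
    rw [hf.arr 0 ha]; exact h.arr⟩

/-- Addition of the universal vertex. -/
def weightsProg : LoopProg :=
  .seq (.assign 2 (.add (.var 0) (.lit 1)))
    (.loop 3 0 (.seq (.store 0 (.var 0) (.var 3) (.lit 1)) (.store 0 (.var 3) (.var 0) (.lit 1))))

theorem runs_weightsProg {n K : ℕ} (hK : n ≤ K) (D : Digraph (Fin n)) :
    Runs K weightsProg (inputState D) (HoldsWeights (extCost D)) := by
  refine .assign_seq ?_
  refine Runs.loop (fun i s => s.var 0 = n ∧ s.var 2 = n + 1 ∧ ∀ a b, s.arr 0 a b =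
      if (a = n ∧ b < i) ∨ (b = n ∧ a < i) then 1 else (inputState D).arr 0 a b) n ?_ hK (by decide)
    (by decide) (by decide) ?_ ?_ ?_
  · simp [inputState]
  · simp [inputState, Expr.eval]
  · rintro i s hi - h3 ⟨h0, h2, ha⟩
    refine .store_seq (.store ?_)
    simp only [Expr.eval, State.setVar_var, State.setArr_var, State.setVar_arr, State.setArr_arr,
      h0, h2, h3, ha, true_and]
    refine ⟨by simp, by simp, fun a b => ?_⟩
    split_ifs <;> first | rfl | omega
  · rintro s - ⟨h0, h2, ha⟩
    refine ⟨h0, h2, fun x y => ?_⟩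
    rw [ha]
    rcases x with _ | x <;> rcases y with _ | y
    · simp [enc, inputState, extCost]
    · simp [enc, extCost]
    · simp [enc, extCost]
    · simp only [enc, extCost, inputState, arcCost, x.2.ne, y.2.ne, false_and, or_self, if_false]
      by_cases hD : D.Adj x y
      · rw [if_pos ⟨rfl, x.2, y.2, hD⟩, if_pos hD]
      · rw [if_neg fun ⟨_, _, _, h⟩ => hD h, if_neg hD]

/-- The constants for the auction: variable `7` receives the number of rounds, and array `3` a table
for `bidWeight`. -/
def constantsProg : LoopProg :=
  .seq (.assign 4 (.add (.var 2) (.lit 1)))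
  (.seq (.assign 5 (.lit 0))
  (.seq (.loop 3 2 (.assign 5 (.add (.var 5) (.var 4))))
  (.seq (.assign 6 (.add (.add (.var 5) (.var 4)) (.lit 2)))
  (.seq (.assign 7 (.lit 0))
  (.seq (.loop 3 2 (.assign 7 (.add (.var 7) (.var 6))))
  (.seq (.store 3 (.lit 0) (.lit 1) (.var 5))
  (.seq (.store 3 (.lit 1) (.lit 0) (.add (.var 5) (.var 4)))
    (.store 3 (.lit 1) (.lit 1) (.add (.var 5) (.var 4))))))))))

/-- The loops multiply by N through repeated addition. With B the largest bid weight, the number of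
rounds is N (B + 2). -/
theorem runs_constantsProg {N K : ℕ} (hK : N ≤ K) {s : State} (h2 : s.var 2 = N)
    (h3 : ∀ i j, s.arr 3 i j = 0) :
    Runs K constantsProg s fun s' =>
      s'.var 7 = N * (N * (N + 1) + (N + 1) + 2) ∧
      s'.arr 3 0 0 = 0 ∧ s'.arr 3 0 1 = N * (N + 1) ∧
      s'.arr 3 1 0 = N * (N + 1) + (N + 1) ∧ s'.arr 3 1 1 = N * (N + 1) + (N + 1) := by
  refine .assign_seq (.assign_seq ?_)
  refine Runs.seq (R := fun s' => s'.var 5 = N * (N + 1) ∧ s'.var 4 = N + 1 ∧ s'.var 2 = N ∧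
      ∀ i j, s'.arr 3 i j = 0) ?_ ?_
  · refine Runs.loop (fun i s' => s'.var 5 = i * (N + 1) ∧ s'.var 4 = N + 1 ∧ s'.var 2 = N ∧
      ∀ i j, s'.arr 3 i j = 0) N (by simpa using h2) hK (by decide) (by decide) (by decide) ?_ ?_ ?_
    · simp [Expr.eval, h2, h3]
    · rintro i s' hi - - ⟨h5, h4, h2, ha⟩
      refine .assign ?_
      simp [Expr.eval, h5, h4, h2, ha, add_one_mul]
    · exact fun _ _ h => h
  rintro s' - ⟨h5, h4, h2, ha⟩
  refine .assign_seq (.assign_seq ?_)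
  refine Runs.seq (R := fun s' => s'.var 7 = N * (N * (N + 1) + (N + 1) + 2) ∧
      s'.var 5 = N * (N + 1) ∧ s'.var 4 = N + 1 ∧ ∀ i j, s'.arr 3 i j = 0) ?_ ?_
  · refine Runs.loop (fun i s' => s'.var 7 = i * (N * (N + 1) + (N + 1) + 2) ∧
      s'.var 6 = N * (N + 1) + (N + 1) + 2 ∧ s'.var 5 = N * (N + 1) ∧ s'.var 4 = N + 1 ∧
      ∀ i j, s'.arr 3 i j = 0) N (by simpa using h2) hK (by decide) (by decide) (by decide) ?_ ?_ ?_
    · simp [Expr.eval, h5, h4, ha]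
    · rintro i s' hi - - ⟨h7, h6, h5, h4, ha⟩
      refine .assign ?_
      simp [Expr.eval, h7, h6, h5, h4, ha, add_one_mul]
    · rintro _ _ ⟨h7, h6, h5, h4, ha⟩
      exact ⟨h7, h5, h4, ha⟩
  rintro s' - ⟨h7, h5, h4, ha⟩
  refine .store_seq (.store_seq (.store ?_))
  simp [Expr.eval, h7, h5, h4, ha]

/-- The entry of `bidWeight` for the values of the variables `i` and `j`. -/
def bidExpr (i j : ℕ) : Expr := .get 3 (.get 0 (.var i) (.var j)) (.get 0 (.var j) (.var i))

/-- Array `3` holds the table for `bidWeight`. -/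
structure HoldsTable (N : ℕ) (s : State) : Prop where
  zero_zero : s.arr 3 0 0 = 0
  zero_one : s.arr 3 0 1 = N * (N + 1)
  one_zero : s.arr 3 1 0 = N * (N + 1) + (N + 1)
  one_one : s.arr 3 1 1 = N * (N + 1) + (N + 1)

theorem eval_bidExpr {n N : ℕ} {w : Option (Fin n) → Option (Fin n) → ℕ} {s : State}
    (hw : ∀ x y, w x y ≤ 1) (h : HoldsWeights w s) (ht : HoldsTable N s) {i j : ℕ}
    {x y : Option (Fin n)} (hi : s.var i = enc x) (hj : s.var j = enc y) :
    (bidExpr i j).eval s = bidWeight w N x y := by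
  simp only [bidExpr, Expr.eval, hi, hj, h.arr, bidWeight]
  rcases Nat.le_one_iff_eq_zero_or_eq_one.1 (hw x y) with h1 | h1 <;>
    rcases Nat.le_one_iff_eq_zero_or_eq_one.1 (hw y x) with h2 | h2 <;>
    simp [h1, h2, ht.zero_zero, ht.zero_one, ht.one_zero, ht.one_one]

/-! ### A round of the auction -/

/-- Variable `9` becomes `x + 1` for a bidder `x` that owns nothing, or `0` if there is none. -/
def findBidderProg : LoopProg :=
  .seq (.assign 9 (.lit 0)) (.loop 10 2 (.ite (.eq (.get 5 (.var 10) (.lit 0)) (.lit 0))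
    (.assign 9 (.add (.var 10) (.lit 1))) .skip))

theorem runs_findBidderProg {N K : ℕ} (hK : N ≤ K) {s : State} (h2 : s.var 2 = N) :
    Runs K findBidderProg s fun s' => (s'.var 9 = 0 ∧ ∀ k < N, s.arr 5 k 0 ≠ 0) ∨
      ∃ k < N, s'.var 9 = k + 1 ∧ s.arr 5 k 0 = 0 := by
  refine .assign_seq ?_
  refine Runs.loop (fun i s' => (s'.var 9 = 0 ∧ ∀ k < i, s.arr 5 k 0 ≠ 0) ∨
      ∃ k < N, s'.var 9 = k + 1 ∧ s.arr 5 k 0 = 0) N (by simpa using h2) hK (by decide)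
    (by decide) (by decide) (by simp [Expr.eval]) ?_ fun _ _ h => h
  intro i s' hi hf hx h
  have ha : s'.arr 5 = s.arr 5 := hf.arr 5 (by decide)
  refine .ite (fun he => .assign ?_) fun he => .skip ?_
  · refine Or.inr ⟨i, hi, ?_, ?_⟩
    · simp [Expr.eval, hx]
    · simpa [Expr.eval, hx, ha] using he
  · refine h.imp (fun h => ⟨by simpa using h.1, fun k hk => ?_⟩) fun h => by simpa using h
    rcases Nat.lt_succ_iff_lt_or_eq.1 hk with hk | rfl
    · exact h.2 k hk
    · simpa [Expr.eval, hx, ha] using he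

/-- Variable `11` becomes the object that is the most profitable one for the bidder in variable `9`. -/
def bestObjectProg : LoopProg :=
  .seq (.assign 11 (.lit 0)) (.loop 12 2 (.ite
    (.lt (.add (bidExpr 9 11) (.get 4 (.var 12) (.lit 0)))
      (.add (bidExpr 9 12) (.get 4 (.var 11) (.lit 0))))
    (.assign 11 (.var 12)) .skip))

/-- A linear scan for the maximum of bid weight minus price; prices are moved to the opposite sides
because subtraction is truncated. -/
theorem runs_bestObjectProg {n K : ℕ} (hK : n + 1 ≤ K) {w : Option (Fin n) → Option (Fin n) → ℕ}
    {s : State} (hw : ∀ x y, w x y ≤ 1) (h : HoldsWeights w s) {N : ℕ} (ht : HoldsTable N s)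
    {x₀ : Option (Fin n)} (h9 : s.var 9 = enc x₀) {p : Option (Fin n) → ℕ}
    (hp : ∀ y, s.arr 4 (enc y) 0 = p y) :
    Runs K bestObjectProg s fun s' => ∃ y₀ : Option (Fin n), s'.var 11 = enc y₀ ∧
      ∀ z, bidWeight w N x₀ z + p y₀ ≤ bidWeight w N x₀ y₀ + p z := by
  refine .assign_seq ?_
  refine Runs.loop (fun i s' => ∃ y₀ : Option (Fin n), s'.var 11 = enc y₀ ∧
      ∀ z, enc z < i → bidWeight w N x₀ z + p y₀ ≤ bidWeight w N x₀ y₀ + p z) (n + 1)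
    (by simpa using h.var_two) hK (by decide) (by decide) (by decide) ?_ ?_ ?_
  · obtain ⟨y, hy⟩ := exists_enc (Nat.succ_pos n)
    exact ⟨y, by simp [Expr.eval, hy], by simp⟩
  · rintro i s' hi hf hx ⟨y₀, h11, hy₀⟩
    obtain ⟨y, rfl⟩ := exists_enc hi
    have e9 : s'.var 9 = enc x₀ := (hf.var 9 (by decide)).trans h9
    have e4 : s'.arr 4 = s.arr 4 := hf.arr 4 (by decide)
    have e0 : HoldsWeights w s' := ⟨(hf.var 0 (by decide)).trans h.var_zero,
      (hf.var 2 (by decide)).trans h.var_two, by rw [hf.arr 0 (by decide)]; exact h.arr⟩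
    have e3 : HoldsTable N s' := by
      have e3 : s'.arr 3 = s.arr 3 := hf.arr 3 (by decide)
      constructor <;> rw [e3]
      exacts [ht.1, ht.2, ht.3, ht.4]
    have e1 := eval_bidExpr hw e0 e3 e9 h11
    have e2 := eval_bidExpr hw e0 e3 e9 hx
    have key : ∀ z, enc z < enc y + 1 → enc z < enc y ∨ z = y := fun z hz =>
      (Nat.lt_succ_iff_lt_or_eq.1 hz).imp_right fun h => enc_injective h
    refine .ite (fun he => .assign ?_) fun he => .skip ?_
    · simp only [Expr.eval, e1, e2, hx, h11, e4, hp, ne_eq, ite_eq_right_iff, one_ne_zero,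
        imp_false, not_not] at he
      refine ⟨y, by simp [Expr.eval, hx], fun z hz => ?_⟩
      rcases key z hz with hz | rfl
      · have := hy₀ z hz
        omega
      · exact le_rfl
    · simp only [Expr.eval, e1, e2, hx, h11, e4, hp, ite_eq_right_iff, one_ne_zero,
        imp_false, not_lt] at he
      refine ⟨y₀, by simpa using h11, fun z hz => ?_⟩
      rcases key z hz with hz | rfl
      · exact hy₀ z hz
      · omega
  · rintro s' - ⟨y₀, h11, hy₀⟩
    exact ⟨y₀, h11, fun z => hy₀ z (enc_lt z)⟩

/-- The owner of the object in variable `11` loses it. -/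
def dismissProg : LoopProg :=
  .loop 10 2 (.ite (.eq (.get 5 (.var 10) (.lit 0)) (.add (.var 11) (.lit 1)))
    (.store 5 (.var 10) (.lit 0) (.lit 0)) .skip)

theorem runs_dismissProg {N K : ℕ} (hK : N ≤ K) {s : State} (h2 : s.var 2 = N) :
    Runs K dismissProg s fun s' => ∀ k < N, s'.arr 5 k 0 =
      if s.arr 5 k 0 = s.var 11 + 1 then 0 else s.arr 5 k 0 := by
  refine Runs.loop (fun i s' => ∀ k < N, s'.arr 5 k 0 =
      if k < i ∧ s.arr 5 k 0 = s.var 11 + 1 then 0 else s.arr 5 k 0) N h2 hK (by decide)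
    (by decide) (by decide) (by simp) ?_ ?_
  · intro i s' hi hf hx h
    have e11 : s'.var 11 = s.var 11 := hf.var 11 (by decide)
    have hii := h i hi
    simp only [lt_self_iff_false, false_and, if_false] at hii
    refine .ite (fun he => .store fun k hk => ?_) fun he => .skip fun k hk => ?_
    · simp only [Expr.eval, hx, e11, hii, ne_eq, ite_eq_right_iff, one_ne_zero, imp_false,
        not_not] at he
      have := h k hk
      simp only [Expr.eval, hx, State.setVar_arr, State.setArr_arr, true_and, and_true, this]
      by_cases hki : k = i
      · subst hki; simp [he]
      · have : k < i + 1 ↔ k < i := by omega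
        simp only [hki, if_false, this]
    · simp only [Expr.eval, hx, e11, hii, ite_eq_right_iff, one_ne_zero, imp_false] at he
      have := h k hk
      simp only [State.setVar_arr, this]
      by_cases hki : k = i
      · subst hki; simp [he]
      · have : k < i + 1 ↔ k < i := by omega
        simp only [this]
  · intro s' _ h k hk
    simpa [hk] using h k hk

/-- One round of the auction. -/
def bidProg : LoopProg :=
  .seq findBidderProg (.ite (.var 9)
    (.seq (.assign 9 (.sub (.var 9) (.lit 1)))
    (.seq bestObjectProg
    (.seq dismissProg
    (.seq (.store 5 (.var 9) (.lit 0) (.add (.var 11) (.lit 1)))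
      (.store 4 (.var 11) (.lit 0) (.add (.get 4 (.var 11) (.lit 0)) (.lit 1)))))))
    .skip)

/-- Arrays `5` and `4` hold the owned objects and the prices. -/
structure HoldsAuction {n : ℕ} (f : Option (Fin n) → Option (Option (Fin n)))
    (p : Option (Fin n) → ℕ) (s : State) : Prop where
  owned : ∀ x, s.arr 5 (enc x) 0 = encOption (f x)
  price : ∀ y, s.arr 4 (enc y) 0 = p y

/-- The final disjunction drives termination: a round either ends with everything assigned or has
raised the total price by exactly 1. -/
theorem runs_bidProg {n K : ℕ} (hK : n + 1 ≤ K) {w : Option (Fin n) → Option (Fin n) → ℕ}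
    {s : State} (hw : ∀ x y, w x y ≤ 1) (h : HoldsWeights w s) {N : ℕ} (ht : HoldsTable N s)
    {f : Option (Fin n) → Option (Option (Fin n))} {p : Option (Fin n) → ℕ} {B : ℕ}
    (hB : ∀ x y, bidWeight w N x y ≤ B)
    (ha : HoldsAuction f p s) (hfp : IsAuction (bidWeight w N) B f p) :
    Runs K bidProg s fun s' => ∃ f' p', HoldsAuction f' p' s' ∧
      IsAuction (bidWeight w N) B f' p' ∧
      ((∀ x, f' x ≠ none) ∨ (∃ x, f x = none) ∧ ∑ y, p' y = ∑ y, p y + 1) := by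
  refine Runs.seq (runs_findBidderProg hK h.var_two) fun s₁ hf₁ h₁ => ?_
  have a₁ : s₁.arr = s.arr := funext fun a => hf₁.arr a (by simp [findBidderProg, arrs])
  refine .ite (fun he => ?_) fun he => ?_
  swap
  · refine .skip ⟨f, p, ⟨by rw [a₁]; exact ha.owned, by rw [a₁]; exact ha.price⟩, hfp, Or.inl ?_⟩
    rcases h₁ with ⟨-, h₁⟩ | ⟨k, -, h₁, -⟩
    · intro x hx
      exact h₁ (enc x) (enc_lt x) (by rw [ha.owned, hx]; rfl)
    · simp only [Expr.eval, h₁] at he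
      omega
  rcases h₁ with ⟨h₁, -⟩ | ⟨k, hk, h9, hk0⟩
  · exact absurd h₁ he
  obtain ⟨x₀, rfl⟩ := exists_enc hk
  have hx₀ : f x₀ = none := by rwa [ha.owned, encOption_eq_zero] at hk0
  refine .assign_seq ?_
  set s₂ := s₁.setVar 9 ((Expr.sub (.var 9) (.lit 1)).eval s₁) with hs₂
  have v₂ : ∀ y, y ≠ 9 → y ≠ 10 → s₂.var y = s.var y := fun y h9 h10 => by
    rw [hs₂, State.setVar_var, if_neg h9]
    exact hf₁.var y (by simp [findBidderProg, vars, h9, h10])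
  have a₂ : s₂.arr = s.arr := a₁
  have e9 : s₂.var 9 = enc x₀ := by simp [hs₂, Expr.eval, h9]
  refine Runs.seq (runs_bestObjectProg (x₀ := x₀) (p := p) (N := N) hK hw
    ⟨(v₂ 0 (by decide) (by decide)).trans h.var_zero, (v₂ 2 (by decide) (by decide)).trans h.var_two,
      by rw [a₂]; exact h.arr⟩ ?_ e9 (by rw [a₂]; exact ha.price)) ?_
  · constructor <;> rw [a₂]
    exacts [ht.1, ht.2, ht.3, ht.4]
  rintro s₃ hf₃ ⟨y₀, h11, hbest⟩
  have a₃ : s₃.arr = s.arr := (funext fun a => hf₃.arr a (by simp [bestObjectProg, arrs])).trans a₂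
  have e9' : s₃.var 9 = enc x₀ := (hf₃.var 9 (by decide)).trans e9
  have e2 : s₃.var 2 = n + 1 := (hf₃.var 2 (by decide)).trans
    ((v₂ 2 (by decide) (by decide)).trans h.var_two)
  refine Runs.seq (runs_dismissProg hK e2) fun s₄ hf₄ h₄ => ?_
  have a₄ : s₄.arr 4 = s.arr 4 := (hf₄.arr 4 (by decide)).trans (by rw [a₃])
  have e9'' : s₄.var 9 = enc x₀ := (hf₄.var 9 (by decide)).trans e9'
  have e11 : s₄.var 11 = enc y₀ := (hf₄.var 11 (by decide)).trans h11
  refine .store_seq (.store ?_)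
  refine ⟨_, _, ⟨fun x => ?_, fun y => ?_⟩, hfp.bid hB hx₀ hbest, Or.inr ⟨⟨x₀, hx₀⟩, sum_bid p y₀⟩⟩
  · simp only [Expr.eval, e9'', e11, State.setArr_var, State.setArr_arr, enc_inj, true_and, and_true,
      h₄ (enc x) (enc_lt x), a₃, h11, ha.owned, encOption_eq_succ]
    rw [if_neg (by simp)]
    split_ifs <;> rfl
  · simp only [Expr.eval, e11, State.setArr_var, State.setArr_arr, enc_inj, true_and, and_true, a₄,
      ha.price, show ¬ (4 : ℕ) = 5 by decide, false_and, if_false]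
    split_ifs with h
    · rw [h]
    · rfl

/-- The auction; the result is written to array `6`. -/
def auctionProg : LoopProg :=
  .seq (.loop 8 7 bidProg) (.loop 8 2
    (.store 6 (.var 8) (.lit 0) (.sub (.get 5 (.var 8) (.lit 0)) (.lit 1))))

/-- Array `6` holds the permutation `σ`. -/
def HoldsPerm {n : ℕ} (σ : Equiv.Perm (Option (Fin n))) (s : State) : Prop :=
  ∀ x, s.arr 6 (enc x) 0 = enc (σ x)

theorem runs_auctionProg {n K : ℕ} {κ : Type*} {w : Option (Fin n) → Option (Fin n) → ℕ}
    {c : Option (Fin n) → κ} (hw : IsSemicompleteWeight w c)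
    (hex : ∃ σ : Equiv.Perm (Option (Fin n)), IsProper c σ) {s : State} (h : HoldsWeights w s)
    (ht : HoldsTable (n + 1) s) (hKn : n + 1 ≤ K) {T : ℕ} (hK : T ≤ K)
    (hT : T = (n + 1) * ((n + 1) * (n + 1 + 1) + (n + 1 + 1) + 2)) (h7 : s.var 7 = T)
    (h5 : ∀ i j, s.arr 5 i j = 0) (h4 : ∀ i j, s.arr 4 i j = 0) :
    Runs K auctionProg s fun s' => ∃ σ, HoldsPerm σ s' ∧ IsOptimal w c σ := by
  set N := n + 1 with hN
  set B := N * (N + 1) + (N + 1) with hB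
  have hbB : ∀ x y, bidWeight w N x y ≤ B := fun x y => by
    unfold bidWeight
    split_ifs <;> omega
  have hcard : Fintype.card (Option (Fin n)) = N := by simp [hN]
  refine Runs.seq (R := fun s' => ∃ f p, HoldsAuction f p s' ∧ IsAuction (bidWeight w N) B f p ∧
    ∀ x, f x ≠ none) ?_ ?_
  · refine Runs.loop (fun i s' => ∃ f p, HoldsAuction f p s' ∧ IsAuction (bidWeight w N) B f p ∧
      ((∀ x, f x ≠ none) ∨ ∑ y, p y = i)) T h7 hK (by decide) (by decide) (by decide) ?_ ?_ ?_
    -- Arrays filled with 0 already encode the initial auction, since 0 stands for owning nothing.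
    · exact ⟨fun _ => none, fun _ => 0, ⟨fun x => by simp [h5, encOption], fun y => by simp [h4]⟩,
        .init _ _, Or.inr (by simp)⟩
    · rintro i s' hi hf - ⟨f, p, ha, hfp, hor⟩
      refine (runs_bidProg hKn hw.le_one (h.of_frame hf (by decide) (by decide) (by decide)) ?_ hbB ha
        hfp).mono ?_
      · have e3 : s'.arr 3 = s.arr 3 := hf.arr 3 (by decide)
        constructor <;> rw [e3]
        exacts [ht.1, ht.2, ht.3, ht.4]
      · rintro s'' - ⟨f', p', ha', hfp', hor'⟩
        refine ⟨f', p', ⟨ha'.owned, ha'.price⟩, hfp', hor'.imp_right fun ⟨⟨x, hx⟩, h'⟩ => ?_⟩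
        rw [h', hor.resolve_left fun h => h x hx]
    · rintro s' - ⟨f, p, ha, hfp, hor⟩
      refine ⟨f, p, ha, hfp, hor.resolve_right fun hsum => ?_⟩
      -- If bidding had gone on in every round, the total price would be T = N (B + 2), but it
      -- cannot exceed N (B + 1).
      have : ∑ y, p y ≤ Fintype.card (Option (Fin n)) * (B + 1) := by
        simpa using Finset.sum_le_card_nsmul Finset.univ p (B + 1) fun y _ => hfp.le y
      rw [hcard, hsum, hT] at this
      have := Nat.le_of_mul_le_mul_left this (by omega)
      omega
  · rintro s₁ hf₁ ⟨f, p, ha, hfp, hf⟩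
    obtain ⟨σ, hσ, hopt⟩ := hfp.exists_perm hf
    rw [← hcard] at hopt
    have h₁ := h.of_frame hf₁ (by decide) (by decide) (by decide)
    refine Runs.loop (fun i s' => ∀ x : Option (Fin n), enc x < i → s'.arr 6 (enc x) 0 = enc (σ x))
      N h₁.var_two hKn (by decide) (by decide) (by decide) (by simp) ?_ ?_
    · intro i s' hi hf hx hI
      obtain ⟨y, rfl⟩ := exists_enc hi
      refine .store fun x hxy => ?_
      have e5 : s'.arr 5 = s₁.arr 5 := hf.arr 5 (by decide)
      simp only [Expr.eval, hx, State.setVar_arr, State.setArr_arr, true_and, and_true, enc_inj, e5,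
        ha.owned, hσ]
      split_ifs with hxy'
      · subst hxy'; rfl
      · exact hI x ((Nat.lt_succ_iff_lt_or_eq.1 hxy).resolve_right fun e => hxy' (enc_injective e))
    · exact fun s' _ hI => ⟨σ, fun x => hI x (enc_lt x), isOptimal_of_bidWeight hw hex hopt⟩

end RAM

/-! ### The program: merging of cycles and output -/

section Cycles

variable {U : Type*} [Fintype U] {σ : Equiv.Perm U} {r : U}

theorem exists_pow_eq_of_sameCycle {x : U} (hr : σ r ≠ r) (h : σ.SameCycle r x) :
    ∃ k < Fintype.card U, (σ ^ k) r = x := by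
  classical
  obtain ⟨k, hk, h'⟩ := h.exists_pow_eq_of_mem_support (Equiv.Perm.mem_support.2 hr)
  exact ⟨k, hk.trans_le (Finset.card_le_univ _), h'⟩

theorem cycleCard_le (σ : Equiv.Perm U) (r : U) : cycleCard σ r ≤ Fintype.card U :=
  Finset.card_le_univ _

theorem cycleCard_pos (σ : Equiv.Perm U) (r : U) : 0 < cycleCard σ r :=
  Finset.card_pos.2 ⟨r, by simpa using Equiv.Perm.SameCycle.refl σ r⟩

theorem cycleCard_eq_card_iff : cycleCard σ r = Fintype.card U ↔ ∀ x, σ.SameCycle r x := by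
  simp [cycleCard, Finset.card_eq_iff_eq_univ, Finset.filter_eq_self]

end Cycles

namespace RAM

open LoopProg

variable {n K : ℕ} {σ : Equiv.Perm (Option (Fin n))} {s : State}
  {w : Option (Fin n) → Option (Fin n) → ℕ}

theorem HoldsPerm.of_arr {s' : State} (h : HoldsPerm σ s) (ha : s'.arr 6 = s.arr 6) :
    HoldsPerm σ s' := fun x => by rw [ha, h x]

/-- The entry of array `6` with the given index. -/
def permExpr (e : Expr) : Expr := .get 6 e (.lit 0)

/-- The entry of array `7` with the given index. -/
def markExpr (e : Expr) : Expr := .get 7 e (.lit 0)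

/-! ### Finding and carrying out exchanges -/

/-- The vertices of the cycle of the universal vertex are marked in array `7`. -/
def markProg : LoopProg :=
  .seq (.loop 12 2 (.store 7 (.var 12) (.lit 0) (.lit 0)))
  (.seq (.assign 13 (.var 0))
    (.loop 12 2 (.seq (.store 7 (.var 13) (.lit 0) (.lit 1))
      (.assign 13 (permExpr (.var 13))))))

open Classical in
/-- Array `7` holds the marks of the vertices of the cycle of the universal vertex. -/
def HoldsMarks (σ : Equiv.Perm (Option (Fin n))) (s : State) : Prop :=
  ∀ x, s.arr 7 (enc x) 0 = if σ.SameCycle none x then 1 else 0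

/-- A walk of n + 1 steps from the universal vertex visits its whole cycle; repeated visits do no
harm. -/
theorem runs_markProg (hK : n + 1 ≤ K) (h0 : s.var 0 = n) (h2 : s.var 2 = n + 1)
    (hσ : HoldsPerm σ s) (hne : σ none ≠ none) : Runs K markProg s (HoldsMarks σ) := by
  classical
  refine Runs.seq (R := fun s' => ∀ x : Option (Fin n), s'.arr 7 (enc x) 0 = 0) ?_ fun s₁ hf₁ h₁ => ?_
  · refine Runs.loop (fun i s' => ∀ k < i, s'.arr 7 k 0 = 0) (n + 1) h2 hK (by decide) (by decide)
      (by decide) (by simp) ?_ fun s' _ h x => h _ (enc_lt x)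
    intro i s' hi hf hx hI
    refine .store fun k hk => ?_
    simp only [Expr.eval, hx, State.setVar_arr, State.setArr_arr, true_and, and_true]
    split_ifs with hki
    · rfl
    · exact hI k (by omega)
  refine .assign_seq ?_
  refine Runs.loop (fun i s' => s'.var 13 = enc ((σ ^ i) none) ∧ ∀ x : Option (Fin n),
    s'.arr 7 (enc x) 0 = if ∃ j < i, (σ ^ j) none = x then 1 else 0) (n + 1)
    (by simpa using (hf₁.var 2 (by decide)).trans h2) hK (by decide) (by decide) (by decide) ?_ ?_ ?_
  · simp [Expr.eval, h₁, hf₁.var 0 (by decide), h0, enc_none]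
  · rintro i s' hi hf hx ⟨h13, hI⟩
    have hσ' : HoldsPerm σ s' := hσ.of_arr ((hf.arr 6 (by decide)).trans (hf₁.arr 6 (by decide)))
    refine .store_seq (.assign ⟨?_, fun x => ?_⟩)
    · simp [Expr.eval, permExpr, h13, hσ' _, pow_succ']
    · simp only [Expr.eval, h13, State.setVar_arr, State.setArr_arr, true_and, and_true, enc_inj, hI]
      by_cases hxi : x = (σ ^ i) none
      · rw [if_pos hxi, if_pos ⟨i, by omega, hxi.symm⟩]
      · rw [if_neg hxi]
        refine if_congr ⟨fun ⟨j, hj, e⟩ => ⟨j, by omega, e⟩, fun ⟨j, hj, e⟩ => ⟨j, ?_, e⟩⟩ rfl rfl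
        rcases Nat.lt_succ_iff_lt_or_eq.1 hj with h | rfl
        · exact h
        · exact absurd e.symm hxi
  · rintro s' - ⟨-, hI⟩ x
    rw [hI x]
    refine if_congr ⟨fun ⟨j, _, e⟩ => ⟨j, by simpa using e⟩, fun h => ?_⟩ rfl rfl
    simpa using exists_pow_eq_of_sameCycle hne h

/-- A search for values of the variables `15`, `16`, `17` for which the test succeeds. They are copied
to the variables `18`, `19`, `20`, and variable `14` tells whether there are any. -/
def searchProg (e : Expr) : LoopProg :=
  .seq (.assign 14 (.lit 0)) (.loop 15 2 (.loop 16 2 (.loop 17 2 (.ite e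
    (.seq (.assign 14 (.lit 1)) (.seq (.assign 18 (.var 15)) (.seq (.assign 19 (.var 16))
      (.assign 20 (.var 17)))))
    .skip))))

/-- The search has found a triple with the property `R`, or there is none with the property `S`. -/
def Searched (R : Option (Fin n) → Option (Fin n) → Option (Fin n) → Prop) (S : ℕ → ℕ → ℕ → Prop)
    (s : State) : Prop :=
  (s.var 14 = 0 ∧ ∀ x y z, S (enc x) (enc y) (enc z) → ¬ R x y z) ∨
    (s.var 14 = 1 ∧ ∃ x y z, R x y z ∧ s.var 18 = enc x ∧ s.var 19 = enc y ∧ s.var 20 = enc z)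

variable {R : Option (Fin n) → Option (Fin n) → Option (Fin n) → Prop}

theorem Searched.mono {S T : ℕ → ℕ → ℕ → Prop} (h : Searched R S s)
    (hST : ∀ a b c, a < n + 1 → b < n + 1 → c < n + 1 → T a b c → S a b c) : Searched R T s :=
  h.imp_left fun h =>
    ⟨h.1, fun x y z hT => h.2 x y z (hST _ _ _ (enc_lt x) (enc_lt y) (enc_lt z) hT)⟩

/-- The set of triples already tested grows lexicographically with the three counters. The search
does not stop at a hit; a later hit overwrites an earlier one. -/
theorem runs_searchProg (hK : n + 1 ≤ K) (h2 : s.var 2 = n + 1) {e : Expr}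
    (he : ∀ s' x y z, s'.arr = s.arr → s'.var 0 = s.var 0 → s'.var 15 = enc x → s'.var 16 = enc y →
      s'.var 17 = enc z → (e.eval s' ≠ 0 ↔ R x y z)) :
    Runs K (searchProg e) s (Searched R fun _ _ _ => True) := by
  refine .assign_seq ?_
  refine Runs.loop (fun i s' => Searched R (fun a _ _ => a < i) s') (n + 1) (by simpa using h2) hK
    (by simp [vars]) (by simp [vars]) (by simp) (Or.inl (by simp [Expr.eval])) ?_
    fun s' _ h => h.mono fun a _ _ ha _ _ _ => ha
  intro i s₁ hi hf₁ h15 hI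
  refine Runs.loop (fun j s' => Searched R (fun a b _ => a < i ∨ a = i ∧ b < j) s') (n + 1)
    ((hf₁.var 2 (by simp [vars])).trans (by simpa using h2)) hK (by simp [vars]) (by simp [vars])
    (by simp) (Searched.mono (S := fun a _ _ => a < i) (by simpa [Searched] using hI) (by simp)) ?_
    fun s' _ h => Searched.mono (S := fun a b _ => a < i ∨ a = i ∧ b < n + 1)
      (by simpa [Searched] using h) fun a b _ _ hb _ ha => by omega
  intro j s₂ hj hf₂ h16 hJ
  refine Runs.loop (fun k s' => Searched R
    (fun a b c => a < i ∨ a = i ∧ (b < j ∨ b = j ∧ c < k)) s') (n + 1)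
    ((hf₂.var 2 (by simp [vars])).trans ((hf₁.var 2 (by simp [vars])).trans (by simpa using h2)))
    hK (by simp [vars]) (by simp [vars]) (by simp)
    (Searched.mono (S := fun a b _ => a < i ∨ a = i ∧ b < j) (by simpa [Searched] using hJ)
      (by simp)) ?_
    fun s' _ h => Searched.mono (S := fun a b c => a < i ∨ a = i ∧ (b < j ∨ b = j ∧ c < n + 1))
      (by simpa [Searched] using h) fun a b c _ _ hc ha => by omega
  intro k s₃ hk hf₃ h17 hL
  obtain ⟨x, rfl⟩ := exists_enc hi
  obtain ⟨y, rfl⟩ := exists_enc hj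
  obtain ⟨z, rfl⟩ := exists_enc hk
  have e15 : s₃.var 15 = enc x :=
    (hf₃.var 15 (by simp [vars])).trans ((hf₂.var 15 (by simp [vars])).trans h15)
  have e16 : s₃.var 16 = enc y := (hf₃.var 16 (by simp [vars])).trans h16
  have e0 : s₃.var 0 = s.var 0 := (hf₃.var 0 (by simp [vars])).trans
    ((hf₂.var 0 (by simp [vars])).trans (hf₁.var 0 (by simp [vars])))
  have ea : s₃.arr = s.arr := funext fun a => (hf₃.arr a (by simp [arrs])).trans
    ((hf₂.arr a (by simp [arrs])).trans (hf₁.arr a (by simp [arrs])))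
  have key := he s₃ x y z ea e0 e15 e16 h17
  refine .ite (fun h => .assign_seq (.assign_seq (.assign_seq (.assign ?_)))) fun h => .skip ?_
  · exact Or.inr ⟨by simp [Expr.eval], x, y, z, key.1 h, by simp [Expr.eval, e15],
      by simp [Expr.eval, e16], by simp [Expr.eval, h17]⟩
  · rcases hL with ⟨h14, hL⟩ | hL
    · refine Or.inl ⟨by simpa using h14, fun x' y' z' hS hR => ?_⟩
      by_cases heq : x' = x ∧ y' = y ∧ z' = z
      · obtain ⟨rfl, rfl, rfl⟩ := heq
        exact key.2 hR h
      · refine hL x' y' z' ?_ hR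
        simp only [← enc_inj] at heq
        omega
    · exact Or.inr (by simpa using hL)

/-- The test whether the images of `x` (variable `16`) and `y` (variable `15`) can be exchanged. -/
def exchangeExpr₁ : Expr :=
  .eq (.add (.add (markExpr (.var 15)) (.sub (.lit 1) (markExpr (.var 16))))
    (.add (.get 0 (.var 15) (permExpr (.var 16))) (.get 0 (.var 16) (permExpr (.var 15))))) (.lit 4)

/-- The test whether `exchange₂` can be applied to `p` (variable `15`), `x` (variable `16`) and `z`
(variable `17`). -/
def exchangeExpr₂ : Expr :=
  .eq (.add (.add
    (.add (markExpr (.var 15)) (.add (.sub (.lit 1) (markExpr (.var 16)))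
      (.sub (.lit 1) (markExpr (.var 17)))))
    (.add (.sub (.lit 1) (.eq (.var 16) (.var 17)))
      (.sub (.lit 1) (.eq (permExpr (.var 15)) (.var 0)))))
    (.add (.add (.get 0 (.var 16) (permExpr (.var 15)))
        (.get 0 (permExpr (.var 15)) (permExpr (.var 16))))
      (.add (.get 0 (.var 15) (permExpr (.var 17)))
        (.get 0 (.var 17) (permExpr (permExpr (.var 15))))))) (.lit 9)

/-- The conjunction is coded as a sum of four values in {0, 1} being equal to 4; the bound on w
keeps every summand at most 1. -/
theorem eval_exchangeExpr₁ (hw : ∀ x y, w x y ≤ 1) (ha : ∀ x y, s.arr 0 (enc x) (enc y) = w x y)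
    (hσ : HoldsPerm σ s) (hm : HoldsMarks σ s) {x y : Option (Fin n)} (h15 : s.var 15 = enc y)
    (h16 : s.var 16 = enc x) :
    exchangeExpr₁.eval s ≠ 0 ↔
      σ.SameCycle none y ∧ ¬ σ.SameCycle none x ∧ w y (σ x) = 1 ∧ w x (σ y) = 1 := by
  have h1 := hw y (σ x)
  have h2 := hw x (σ y)
  simp only [exchangeExpr₁, markExpr, permExpr, Expr.eval, h15, h16, hm _, hσ _, ha]
  generalize w y (σ x) = a₁ at *
  generalize w x (σ y) = a₂ at *
  by_cases c1 : σ.SameCycle none y <;> by_cases c2 : σ.SameCycle none x <;>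
    simp only [c1, c2, if_true, if_false, ne_eq, not_true_eq_false, not_false_eq_true,
      true_and, false_and, and_false, ite_eq_right_iff, one_ne_zero, imp_false, not_not, iff_false] <;>
    omega

theorem eval_exchangeExpr₂ (hw : ∀ x y, w x y ≤ 1) (ha : ∀ x y, s.arr 0 (enc x) (enc y) = w x y)
    (h0 : s.var 0 = n) (hσ : HoldsPerm σ s) (hm : HoldsMarks σ s) {p x z : Option (Fin n)}
    (h15 : s.var 15 = enc p) (h16 : s.var 16 = enc x) (h17 : s.var 17 = enc z) :
    exchangeExpr₂.eval s ≠ 0 ↔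
      σ.SameCycle none p ∧ ¬ σ.SameCycle none x ∧ ¬ σ.SameCycle none z ∧ x ≠ z ∧ σ p ≠ none ∧
        w x (σ p) = 1 ∧ w (σ p) (σ x) = 1 ∧ w p (σ z) = 1 ∧ w z (σ (σ p)) = 1 := by
  have h1 := hw x (σ p)
  have h2 := hw (σ p) (σ x)
  have h3 := hw p (σ z)
  have h4 := hw z (σ (σ p))
  have h5 : enc (σ p) = n ↔ σ p = none := enc_inj (y := none)
  simp only [exchangeExpr₂, markExpr, permExpr, Expr.eval, h15, h16, h17, h0, hm _, hσ _, ha,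
    enc_inj, h5]
  generalize w x (σ p) = a₁ at *
  generalize w (σ p) (σ x) = a₂ at *
  generalize w p (σ z) = a₃ at *
  generalize w z (σ (σ p)) = a₄ at *
  by_cases c1 : σ.SameCycle none p <;> by_cases c2 : σ.SameCycle none x <;>
    by_cases c3 : σ.SameCycle none z <;> by_cases c4 : x = z <;> by_cases c5 : σ p = none <;>
    simp only [c1, c2, c3, c4, c5, if_true, if_false, ne_eq, not_true_eq_false, not_false_eq_true,
      true_and, false_and, and_false, ite_eq_right_iff, one_ne_zero, imp_false, not_not, iff_false] <;>
    omega

/-- The exchange of two images. -/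
def exchangeProg₁ : LoopProg :=
  .seq (.assign 21 (permExpr (.var 18)))
  (.seq (.store 6 (.var 18) (.lit 0) (permExpr (.var 19)))
    (.store 6 (.var 19) (.lit 0) (.var 21)))

/-- The program for `exchange₂`. -/
def exchangeProg₂ : LoopProg :=
  .seq (.assign 21 (permExpr (.var 18)))
  (.seq (.assign 22 (permExpr (.var 21)))
  (.seq (.assign 23 (permExpr (.var 19)))
  (.seq (.assign 24 (permExpr (.var 20)))
  (.seq (.store 6 (.var 19) (.lit 0) (.var 21))
  (.seq (.store 6 (.var 21) (.lit 0) (.var 23))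
  (.seq (.store 6 (.var 18) (.lit 0) (.var 24))
    (.store 6 (.var 20) (.lit 0) (.var 22))))))))

theorem runs_exchangeProg₁ (hσ : HoldsPerm σ s) {x y : Option (Fin n)} (h18 : s.var 18 = enc y)
    (h19 : s.var 19 = enc x) : Runs K exchangeProg₁ s (HoldsPerm (exchange₁ σ y x)) := by
  refine .assign_seq (.store_seq (.store fun v => ?_))
  simp only [Expr.eval, permExpr, State.setVar_var, State.setVar_arr, State.setArr_arr,
    State.setArr_var, h18, h19, hσ _, exchange₁_apply]
  simp only [Nat.reduceEqDiff, if_false, if_true, true_and, and_true, enc_inj, hσ _]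
  split_ifs <;> rfl

/-- All old images are saved before the first store. The hypotheses make the four changed positions
distinct. -/
theorem runs_exchangeProg₂ (hσ : HoldsPerm σ s) {p x z : Option (Fin n)} (hne : ∀ v, σ v ≠ v)
    (hp : σ.SameCycle none p) (hx : ¬ σ.SameCycle none x) (hz : ¬ σ.SameCycle none z) (hxz : x ≠ z)
    (h18 : s.var 18 = enc p) (h19 : s.var 19 = enc x) (h20 : s.var 20 = enc z) :
    Runs K exchangeProg₂ s (HoldsPerm (exchange₂ σ p x z)) := by
  refine .assign_seq (.assign_seq (.assign_seq (.assign_seq (.store_seq (.store_seq (.store_seq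
    (.store fun v => ?_)))))))
  rw [exchange₂_apply_of_sameCycle hne hp hx hz hxz]
  simp only [Expr.eval, permExpr, State.setVar_var, State.setVar_arr, State.setArr_arr,
    State.setArr_var, Nat.reduceEqDiff, if_false, if_true, true_and, and_true,
    h18, h19, h20, hσ _, enc_inj]
  split_ifs <;> rfl

/-- One round of merging. -/
def mergeProg : LoopProg :=
  .seq markProg (.seq (searchProg exchangeExpr₁) (.ite (.var 14) exchangeProg₁
    (.seq (searchProg exchangeExpr₂) (.ite (.var 14) exchangeProg₂ .skip))))

/-- If both searches fail, no exchange is possible, and `sameCycle_of_no_exchange` says that the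
cycle is already full. -/
theorem runs_mergeProg (hK : n + 1 ≤ K) {κ : Type*} {c : Option (Fin n) → κ}
    (hw : IsSemicompleteWeight w c) (hr : ∀ x, x ≠ none → w none x = 1 ∧ w x none = 1)
    (h : HoldsWeights w s) (hσ : HoldsPerm σ s) (hopt : IsOptimal w c σ) :
    Runs K mergeProg s fun s' => ∃ σ', HoldsPerm σ' s' ∧ IsOptimal w c σ' ∧
      (cycleCard σ' none = n + 1 ∨ cycleCard σ none < cycleCard σ' none) := by
  have hne := hopt.1.apply_ne
  refine Runs.seq (runs_markProg hK h.var_zero h.var_two hσ (hne none)) fun s₁ hf₁ hm₁ => ?_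
  have h₁ := h.of_frame hf₁ (by decide) (by decide) (by decide)
  have hσ₁ : HoldsPerm σ s₁ := hσ.of_arr (hf₁.arr 6 (by decide))
  refine Runs.seq (runs_searchProg hK h₁.var_two (R := fun y x _ => σ.SameCycle none y ∧
    ¬ σ.SameCycle none x ∧ w y (σ x) = 1 ∧ w x (σ y) = 1) ?_) fun s₂ hf₂ hs₂ => ?_
  · intro s' y x z ha _ h15 h16 _
    exact eval_exchangeExpr₁ hw.le_one (by rw [ha]; exact h₁.arr) (hσ₁.of_arr (by rw [ha]))
      (by unfold HoldsMarks; rw [ha]; exact hm₁) h15 h16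
  have a₂ : s₂.arr = s₁.arr := funext fun a => hf₂.arr a (by simp [searchProg, arrs])
  have hσ₂ : HoldsPerm σ s₂ := hσ₁.of_arr (by rw [a₂])
  refine .ite (fun h14 => ?_) fun h14 => ?_
  · rcases hs₂ with ⟨h, -⟩ | ⟨-, y, x, z, ⟨hy, hx, h1, h2⟩, h18, h19, -⟩
    · exact absurd h h14
    · exact (runs_exchangeProg₁ hσ₂ h18 h19).mono fun s' _ hs' =>
        ⟨_, hs', hopt.exchange₁ hw h1 h2, Or.inr (cycleCard_exchange₁_lt hy hx)⟩
  rcases hs₂ with ⟨-, hno₁⟩ | ⟨h, -⟩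
  swap
  · rw [Expr.eval, h] at h14
    exact absurd h14 one_ne_zero
  have h₂ := h₁.of_frame hf₂ (by simp [searchProg, vars]) (by simp [searchProg, vars])
    (by simp [searchProg, arrs])
  refine Runs.seq (runs_searchProg hK h₂.var_two (R := fun p x z => σ.SameCycle none p ∧
    ¬ σ.SameCycle none x ∧ ¬ σ.SameCycle none z ∧ x ≠ z ∧ σ p ≠ none ∧
        w x (σ p) = 1 ∧ w (σ p) (σ x) = 1 ∧ w p (σ z) = 1 ∧ w z (σ (σ p)) = 1) ?_)
    fun s₃ hf₃ hs₃ => ?_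
  · intro s' y x z ha h0 h15 h16 h17
    exact eval_exchangeExpr₂ hw.le_one (by rw [ha]; exact h₂.arr) (h0.trans h₂.var_zero)
      (hσ₂.of_arr (by rw [ha])) (by unfold HoldsMarks; rw [ha, a₂]; exact hm₁) h15 h16 h17
  have hσ₃ : HoldsPerm σ s₃ := hσ₂.of_arr (hf₃.arr 6 (by simp [searchProg, arrs]))
  refine .ite (fun h14 => ?_) fun h14 => ?_
  · rcases hs₃ with ⟨h, -⟩ | ⟨-, p, x, z, ⟨hp, hx, hz, hxz, hq, h1, h2, h3, h4⟩, h18, h19, h20⟩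
    · exact absurd h h14
    · exact (runs_exchangeProg₂ hσ₃ hne hp hx hz hxz h18 h19 h20).mono fun s' _ hs' =>
        ⟨_, hs', hopt.exchange₂ hw hp hx hz hxz h1 h2 h3 h4,
          Or.inr (cycleCard_exchange₂_lt hne hp hx hz hxz hq)⟩
  rcases hs₃ with ⟨-, hno₂⟩ | ⟨h, -⟩
  swap
  · rw [Expr.eval, h] at h14
    exact absurd h14 one_ne_zero
  refine .skip ⟨σ, hσ₃, hopt, Or.inl ?_⟩
  have : Fintype.card (Option (Fin n)) = n + 1 := by simp
  rw [← this, cycleCard_eq_card_iff]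
  exact sameCycle_of_no_exchange hw hr hopt.1
    (fun y x hy hx h => hno₁ y x none trivial ⟨hy, hx, h⟩)
    fun p x z hp hx hz hxz hq h => hno₂ p x z trivial ⟨hp, hx, hz, hxz, hq, h⟩

/-- The cycle has at least one element at the start and gains at least one per round until it is
full, so n + 1 rounds suffice. -/
theorem runs_loop_mergeProg (hK : n + 1 ≤ K) {κ : Type*} {c : Option (Fin n) → κ}
    (hw : IsSemicompleteWeight w c) (hr : ∀ x, x ≠ none → w none x = 1 ∧ w x none = 1)
    (h : HoldsWeights w s) (hσ : HoldsPerm σ s) (hopt : IsOptimal w c σ) :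
    Runs K (.loop 8 2 mergeProg) s fun s' => ∃ σ, HoldsPerm σ s' ∧ IsOptimal w c σ ∧
      ∀ x, σ.SameCycle none x := by
  have hcard : Fintype.card (Option (Fin n)) = n + 1 := by simp
  refine Runs.loop (fun i s' => ∃ σ, HoldsPerm σ s' ∧ IsOptimal w c σ ∧
    (cycleCard σ none = n + 1 ∨ i < cycleCard σ none)) (n + 1) h.var_two hK (by decide) (by decide)
    (by decide) ⟨σ, hσ, hopt, Or.inr (cycleCard_pos σ none)⟩ ?_ ?_
  · rintro i s' hi hf - ⟨σ', hσ', hopt', hc⟩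
    refine (runs_mergeProg hK hw hr (h.of_frame hf (by decide) (by decide) (by decide)) hσ'
      hopt').mono ?_
    rintro s'' - ⟨τ, hτ, hoptτ, hcτ⟩
    have := cycleCard_le τ none
    exact ⟨τ, hτ, hoptτ, by omega⟩
  · rintro s' - ⟨σ', hσ', hopt', hc⟩
    refine ⟨σ', hσ', hopt', cycleCard_eq_card_iff.1 ?_⟩
    have := cycleCard_le σ' none
    omega

/-- The cycle is written to the output arrays, and the number of its arcs in the digraph to
variable `1`. -/
def outputProg : LoopProg :=
  .seq (.assign 13 (permExpr (.var 0)))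
  (.seq (.assign 1 (.lit 0))
  (.seq (.loop 8 0
    (.seq (.store 1 (.var 8) (.lit 0) (.var 13))
    (.seq (.assign 19 (permExpr (.var 13)))
    (.seq (.store 2 (.var 8) (.lit 0) (.get 0 (.var 13) (.var 19)))
    (.seq (.assign 1 (.add (.var 1) (.get 0 (.var 13) (.var 19))))
      (.assign 13 (.var 19)))))))
    (.assign 1 (.sub (.var 1) (.lit 1)))))

/-- If σ is a single cycle, the last of the n summed arcs returns to the universal vertex; the
subtraction removes its weight 1. -/
theorem runs_outputProg (hK : n ≤ K) (h : HoldsWeights w s) (hσ : HoldsPerm σ s) :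
    Runs K outputProg s fun s' =>
      s'.var 1 = (∑ i ∈ Finset.range n, w ((σ ^ (i + 1)) none) ((σ ^ (i + 1 + 1)) none)) - 1 ∧
      ∀ i < n, s'.arr 1 i 0 = enc ((σ ^ (i + 1)) none) ∧
        s'.arr 2 i 0 = w ((σ ^ (i + 1)) none) ((σ ^ (i + 1 + 1)) none) := by
  refine .assign_seq (.assign_seq ?_)
  refine Runs.seq (R := fun s' =>
      s'.var 1 = (∑ i ∈ Finset.range n, w ((σ ^ (i + 1)) none) ((σ ^ (i + 1 + 1)) none)) ∧
      ∀ i < n, s'.arr 1 i 0 = enc ((σ ^ (i + 1)) none) ∧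
        s'.arr 2 i 0 = w ((σ ^ (i + 1)) none) ((σ ^ (i + 1 + 1)) none)) ?_ ?_
  · refine Runs.loop (fun k s' => s'.var 13 = enc ((σ ^ (k + 1)) none) ∧
      s'.var 1 = (∑ i ∈ Finset.range k, w ((σ ^ (i + 1)) none) ((σ ^ (i + 1 + 1)) none)) ∧
      ∀ i < k, s'.arr 1 i 0 = enc ((σ ^ (i + 1)) none) ∧
        s'.arr 2 i 0 = w ((σ ^ (i + 1)) none) ((σ ^ (i + 1 + 1)) none)) n
      (by simpa using h.var_zero) hK (by decide) (by decide) (by decide) ?_ ?_ ?_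
    · have := hσ none
      rw [enc_none] at this
      simp [Expr.eval, permExpr, h.var_zero, this]
    · rintro k s' hk hf h8 ⟨h13, h1, hI⟩
      have hσ' : HoldsPerm σ s' := hσ.of_arr (hf.arr 6 (by decide))
      have ha : ∀ x y, s'.arr 0 (enc x) (enc y) = w x y := by
        rw [hf.arr 0 (by decide)]; exact h.arr
      have hp : σ ((σ ^ (k + 1)) none) = (σ ^ (k + 1 + 1)) none := by
        rw [pow_succ' σ (k + 1), Equiv.Perm.mul_apply]
      refine .store_seq (.assign_seq (.store_seq (.assign_seq (.assign ⟨?_, ?_, fun i hi => ?_⟩))))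
      · simp [Expr.eval, permExpr, h13, hσ' _, hp]
      · simp [Expr.eval, permExpr, h13, hσ' _, hp, h1, ha, Finset.sum_range_succ]
      · simp only [Expr.eval, permExpr, State.setVar_var, State.setVar_arr, State.setArr_arr,
          State.setArr_var, Nat.reduceEqDiff, OfNat.one_ne_ofNat,
          OfNat.ofNat_ne_one, OfNat.zero_ne_ofNat, if_false, if_true, true_and, and_true, false_and,
          h8, h13, hσ' _, hp, ha]
        by_cases hik : i = k
        · subst hik; simp
        · simpa [hik] using hI i (by omega)
    · rintro s' - ⟨-, h⟩
      exact h
  · rintro s' - ⟨h1, hI⟩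
    refine .assign ⟨?_, hI⟩
    simp [Expr.eval, h1]

/-- The whole program. -/
def pathProg : LoopProg :=
  .seq weightsProg (.seq constantsProg (.seq auctionProg (.seq (.loop 8 2 mergeProg) outputProg)))

/-- A bound for the loop counters of `pathProg`. -/
noncomputable def pathBound : Polynomial ℕ :=
  (Polynomial.X + 1) * ((Polynomial.X + 1) * (Polynomial.X + 1 + 1) + (Polynomial.X + 1 + 1) + 2)

theorem runs_pathProg (D : Digraph (Fin n)) (hD : IsSemicompleteMultipartite D)
    (hm : HPMajority D) :
    Runs (pathBound.eval n) pathProg (inputState D) fun s =>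
      IsGreatest (hamiltonSigmaValues D) (s.var 1) ∧
      ∃ P : OrientedPath D n, P.IsHamilton ∧ P.sigmaMax = s.var 1 ∧ OutputsPath s P := by
  obtain ⟨p, c, hp, hsurj, hc⟩ := hD
  have hn2 : 2 ≤ n := by simpa using two_le_card hp hsurj
  have : Nonempty (Fin n) := ⟨⟨0, by omega⟩⟩
  have hw := isSemicompleteWeight_extCost hc
  set T := (n + 1) * ((n + 1) * (n + 1 + 1) + (n + 1 + 1) + 2) with hT
  have hK : pathBound.eval n = T := by simp [pathBound, hT]
  rw [hK]
  have hKn : n + 1 ≤ T := Nat.le_mul_of_pos_right _ (by omega)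
  refine Runs.seq (runs_weightsProg (by omega) D) fun s₁ hf₁ h₁ => ?_
  have z₁ : ∀ a, a ≠ 0 → ∀ i j, s₁.arr a i j = 0 := fun a ha i j => by
    rw [hf₁.arr a (by simp [weightsProg, arrs, ha])]
    simp [inputState, ha]
  refine Runs.seq (runs_constantsProg hKn h₁.var_two (z₁ 3 (by decide)))
    fun s₂ hf₂ ⟨h7, t00, t01, t10, t11⟩ => ?_
  have h₂ := h₁.of_frame hf₂ (by decide) (by decide) (by decide)
  refine Runs.seq (runs_auctionProg hw (exists_isProper_option hp hsurj hc hm) h₂ ⟨t00, t01, t10, t11⟩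
    hKn le_rfl hT h7 (by rw [hf₂.arr 5 (by decide)]; exact z₁ 5 (by decide))
    (by rw [hf₂.arr 4 (by decide)]; exact z₁ 4 (by decide))) fun s₃ hf₃ ⟨σ₃, hσ₃, hopt₃⟩ => ?_
  have h₃ := h₂.of_frame hf₃ (by decide) (by decide) (by decide)
  refine Runs.seq (runs_loop_mergeProg hKn hw (extCost_none D) h₃ hσ₃ hopt₃)
    fun s₄ hf₄ ⟨σ, hσ, hopt, hfull⟩ => ?_
  have h₄ := h₃.of_frame hf₄ (by decide) (by decide) (by decide)
  refine (runs_outputProg (by omega) h₄ hσ).mono fun s' _ ⟨h1, hout⟩ => ?_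
  obtain ⟨P, hP, hF, hvert, hfwd, hsum⟩ := exists_path_of_perm (Fintype.card_fin n) (by omega) hc hopt
    hfull
  obtain ⟨hmax, hG, -⟩ := isGreatest_of_factorCost_le hP hF
  -- Of the two arcs at `none`, the outgoing one is split off from the sum here; the incoming one
  -- was subtracted by the program.
  have hs : P.sigmaPlus = s'.var 1 := by
    rw [Finset.sum_range_succ', pow_zero, zero_add, pow_one, Equiv.Perm.one_apply,
      (extCost_none D _ (hopt.1.apply_ne none)).1] at hsum
    omega
  refine ⟨hs ▸ hG, P, hP, hmax.trans hs, fun i => ?_, fun i => ?_⟩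
  · rw [(hout i i.2).1, ← hvert i]
    rfl
  · have e1 := hvert ⟨i, by omega⟩
    have e2 := hvert ⟨i + 1, by omega⟩
    simp only at e1 e2
    rw [(hout i (by omega)).2, ← e1, ← e2, extCost, arcCost]
    by_cases hf : P.fwd i = true
    · rw [if_pos hf, if_pos ((hfwd i).1 hf)]
    · rw [if_neg hf, if_neg fun h => hf ((hfwd i).2 h)]

end RAM

end HamOP

open HamOP in
/-- For every semicomplete multipartite digraph `D` with the HP-majority inequality, the maxima
`σ^hp_max` and `c^pc_max` exist and are equal. Moreover, a single program computes, in time polynomial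
in the number `n` of vertices, the value `σ^hp_max` (in variable `1`) and a Hamilton oriented path `P`
with `σ_max(P) = σ^hp_max` (in arrays `1` and `2`). -/
theorem theorem1p6 :
    (∀ (V : Type*) [Fintype V] (D : Digraph V), IsSemicompleteMultipartite D → HPMajority D →
      ∃ m : ℕ, IsGreatest (hamiltonSigmaValues D) m ∧ IsGreatest (factorCosts D) m) ∧
    (∃ (prog : RAM.Prog) (q : Polynomial ℕ),
      ∀ (n : ℕ) (D : Digraph (Fin n)), IsSemicompleteMultipartite D → HPMajority D →
        ∃ (t : ℕ) (s : RAM.State), RAM.Exec prog (inputState D) t s ∧ t ≤ q.eval n ∧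
          IsGreatest (hamiltonSigmaValues D) (s.var 1) ∧
          ∃ P : OrientedPath D n, P.IsHamilton ∧ P.sigmaMax = s.var 1 ∧ OutputsPath s P) := by
  -- The cost is a polynomial in a bound for the loop counters, and that bound is a polynomial in n;
  -- the running time is bounded by their composition.
  refine ⟨fun V _ D hD hm => exists_isGreatest hD hm, RAM.pathProg.compile,
    RAM.pathProg.cost.comp RAM.pathBound, fun n D hD hm => ?_⟩
  obtain ⟨t, s, h1, h2, -, h3⟩ := RAM.runs_pathProg D hD hm
  exact ⟨t, s, h1, by rwa [Polynomial.eval_comp], h3⟩
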